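/- Let $S$ be a quantum system with Hilbert space $\mathcal H_S$ of finite dimension $d\ge 1$, and let $\{\Lambda_t\}_{t\ge 0}$ be a dynamics on $S$: a family of completely positive trace preserving (CPTP) linear maps on $B(\mathcal H_S)$. Suppose that it is bijective or at most point-wise non-bijective, i.e. every time interval of positive length contains a time $t$ at which $\Lambda_t$ is bijective. For $t\le s$, an intermediate map $V_{s,t}$ is a trace preserving linear map with $\Lambda_s=V_{s,t}\Lambda_t$; if $\Lambda_t$ is bijective there is exactly one, $V_{s,t}=\Lambda_s\Lambda_t^{-1}$. For a bipartite state $\rho_{AB}$, an $n$-output POVM $\{P_i\}_{i=1}^n$ on $A$ is maximally entropic (ME) if each outcome has probability $1/n$. It prepares on $B$ the ensemble $\mathcal E(\rho_{AB},\{P_i\})$ with probabilities $p_i=1/n$ and states $\rho_{B,i}=\mathrm{Tr}_A[\rho_{AB}(P_i\otimes 1)]/p_i$. The guessing probability of an ensemble is $P_g(\{p_i,\rho_i\})=\max_{\{Q_i\}}\sum_i p_i\mathrm{Tr}[\rho_iQ_i]$, over POVMs. Put $C_A^{(n)}(\rho_{AB})=\max P_g(\mathcal E(\rho_{AB},\{P_i\}))-\frac1n$,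 over all $n$-output ME-POVMs on $A$, and $C_A(\rho_{AB})=\sup P_g(\mathcal E(\rho_{AB},\{P_i\}))-\frac12$, over all ME-POVMs on $A$ with any number $n\ge2$ of outputs. Define $C_B^{(n)}$, $C_B$ by exchanging $A$ and $B$, and $C^{(2)}=\max\{C^{(2)}_A,C^{(2)}_B\}$, $C=\max\{C_A,C_B\}$. Let $A$ be a qubit and $B=A'S$ with a finite-dimensional ancilla $A'$. A pair of states $\rho',\rho''$ of $A'S$ gives the probe $$\rho_{AB}(t)=\tfrac12\big(|0\rangle\langle0|_A\otimes\rho'(t)+|1\rangle\langle1|_A\otimes\rho''(t)\big),\qquad \rho'(t)=(\mathcal I_{A'}\otimes\Lambda_t)(\rho'),\quad \rho''(t)=(\mathcal I_{A'}\otimes\Lambda_t)(\rho'').$$ Then: 1. For all $A'$, all states $\rho',\rho''$ and all $t\ge0$, the probe $\rho_{AB}(t)$ satisfies $$C=C^{(2)}=C^{(2)}_A=\tfrac14\|\rho'(t)-\rho''(t)\|_1,\qquad C_A=C_A^{(2)},\quad C_B=C_B^{(2)}\le C_A^{(2)} .$$ 2. There are pairs of states $\rho'^{(\tau)},\rho''^{(\tau)}$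 of $A'S$, one pair for each $\tau\ge0$, with $\dim\mathcal H_{A'}=d+1$, whose probes $\rho^{(\tau)}_{AB}$ satisfy: (a) for every $\tau$ at which $\Lambda_\tau$ is bijective and every $\Delta t>0$, $$C^{(2)}(\rho^{(\tau)}_{AB}(\tau+\Delta t))>C^{(2)}(\rho^{(\tau)}_{AB}(\tau))\iff\text{there is no completely positive intermediate map }V_{\tau+\Delta t,\tau};$$ (b) if moreover $t\mapsto\Lambda_t$ is continuous, then for all $\tau\ge0$ and $\Delta t>0$ (whether $\Lambda_\tau$ is bijective or not) such that there is no completely positive intermediate map $V_{\tau+\Delta t,\tau}$, there are times $\tau'\in(\tau,\tau+\Delta t)$ arbitrarily close to $\tau$ with $\Lambda_{\tau'}$ bijective and $C^{(2)}(\rho^{(\tau')}_{AB}(\tau+\Delta t))>C^{(2)}(\rho^{(\tau')}_{AB}(\tau'))$. 3. For all $\tau\ge0$ and $\Delta t>0$ (whether $\Lambda_\tau$ is bijective or not): (a) if some probe, with any ancilla $A'$, satisfies $C^{(2)}(\rho_{AB}(\tau+\Delta t))>C^{(2)}(\rho_{AB}(\tau))$, then there is no completely positive intermediate map $V_{\tau+\Delta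 t,\tau}$; (b) if there is no completely positive linear map $W$ on $B(\mathcal H_S)$, trace preserving or not, with $\Lambda_{\tau+\Delta t}=W\Lambda_\tau$, then some probe with $\dim\mathcal H_{A'}=d+1$ satisfies $C^{(2)}(\rho_{AB}(\tau+\Delta t))>C^{(2)}(\rho_{AB}(\tau))$. -/

import Mathlib

open scoped Kronecker NNReal ComplexOrder

noncomputable section

/-! ### States, linear maps on operators, complete positivity -/

/-- A density matrix. -/
def IsState {a : Type*} [Fintype a] (ρ : Matrix a a ℂ) : Prop :=
  ρ.PosSemidef ∧ ρ.trace = 1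

/-- The trace norm `‖X‖₁ = Tr √(Xᴴ X)`, i.e. the sum of the singular values of `X`. -/
def traceNorm {a : Type*} [Fintype a] [DecidableEq a] (X : Matrix a a ℂ) : ℝ :=
  ∑ i, Real.sqrt ((Matrix.isHermitian_conjTranspose_mul_self X).eigenvalues i)

/-- Linear maps on the operators of a finite-dimensional Hilbert space with basis `S`. -/
abbrev OpMap (S : Type*) := Matrix S S ℂ →ₗ[ℂ] Matrix S S ℂ

/-- `(id_k ⊗ Φ)(X)`: the map `Φ` acts on each `S × S` block of `X`. -/
def idTensor {S : Type*} (k : Type*) (Φ : OpMap S) (X : Matrix (k × S) (k × S) ℂ) :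
    Matrix (k × S) (k × S) ℂ :=
  Matrix.of fun p q => Φ (Matrix.of fun i j => X (p.1, i) (q.1, j)) p.2 q.2

/-- Complete positivity: `id_k ⊗ Φ` preserves positivity for every ancilla dimension `k`. -/
def IsCP {S : Type*} [Fintype S] (Φ : OpMap S) : Prop :=
  ∀ (k : ℕ) (X : Matrix (Fin k × S) (Fin k × S) ℂ),
    X.PosSemidef → (idTensor (Fin k) Φ X).PosSemidef

/-- Trace preservation. -/
def IsTP {S : Type*} [Fintype S] (Φ : OpMap S) : Prop :=
  ∀ X : Matrix S S ℂ, (Φ X).trace = X.trace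

/-! ### Dynamics and intermediate maps -/

/-- A dynamics: a family of completely positive trace preserving maps indexed by time `t ≥ 0`. -/
def IsDynamics {S : Type*} [Fintype S] (Λ : ℝ≥0 → OpMap S) : Prop :=
  ∀ t, IsCP (Λ t) ∧ IsTP (Λ t)

/-- The dynamics is bijective or at most point-wise non-bijective: it is not non-bijective
throughout any time interval of positive length. -/
def IsAtMostPointwiseNonBijective {S : Type*} (Λ : ℝ≥0 → OpMap S) : Prop :=
  ∀ a b : ℝ≥0, a < b → ∃ t ∈ Set.Ioo a b, Function.Bijective (Λ t)

/-- `V` is an intermediate map `V_{s,t}`: it is linear, trace preserving and `Λ_s = V Λ_t`. -/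
def IsIntermediateMap {S : Type*} [Fintype S] (Λ : ℝ≥0 → OpMap S) (s t : ℝ≥0)
    (V : OpMap S) : Prop :=
  IsTP V ∧ Λ s = V ∘ₗ Λ t

/-! ### Measurements, ensembles and the guessing probability -/

/-- An `n`-output POVM. -/
def IsPOVM {a : Type*} [Fintype a] [DecidableEq a] {n : ℕ} (P : Fin n → Matrix a a ℂ) : Prop :=
  (∀ i, (P i).PosSemidef) ∧ ∑ i, P i = 1

/-- An `n`-output maximally entropic POVM for `ρ`: all outcomes have probability `1 / n`. -/
def IsMEPOVM {a : Type*} [Fintype a] [DecidableEq a] {n : ℕ} (ρ : Matrix a a ℂ)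
    (P : Fin n → Matrix a a ℂ) : Prop :=
  IsPOVM P ∧ ∀ i, (ρ * P i).trace = 1 / (n : ℂ)

/-- The guessing probability of the ensemble `{p i, σ i}`. -/
def guessProb {b : Type*} [Fintype b] [DecidableEq b] {n : ℕ} (p : Fin n → ℝ)
    (σ : Fin n → Matrix b b ℂ) : ℝ :=
  sSup {g : ℝ | ∃ Q : Fin n → Matrix b b ℂ,
    IsPOVM Q ∧ g = ∑ i, p i * ((σ i * Q i).trace).re}

/-- Partial trace over the first factor. -/
def traceFst {a b : Type*} [Fintype a] (ρ : Matrix (a × b) (a × b) ℂ) : Matrix b b ℂ :=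
  Matrix.of fun i j => ∑ x, ρ (x, i) (x, j)

/-- Partial trace over the second factor. -/
def traceSnd {a b : Type*} [Fintype b] (ρ : Matrix (a × b) (a × b) ℂ) : Matrix a a ℂ :=
  Matrix.of fun i j => ∑ y, ρ (i, y) (j, y)

/-- Probability of an outcome with effect `P`, measured on the first factor. -/
def outcomeProb {a b : Type*} [Fintype a] [Fintype b] [DecidableEq b]
    (ρ : Matrix (a × b) (a × b) ℂ) (P : Matrix a a ℂ) : ℝ :=
  ((ρ * (P ⊗ₖ (1 : Matrix b b ℂ))).trace).re

/-- State of the second factor after an outcome with effect `P` on the first factor. -/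
def outcomeState {a b : Type*} [Fintype a] [Fintype b] [DecidableEq b]
    (ρ : Matrix (a × b) (a × b) ℂ) (P : Matrix a a ℂ) : Matrix b b ℂ :=
  ((outcomeProb ρ P : ℂ))⁻¹ • traceFst (ρ * (P ⊗ₖ (1 : Matrix b b ℂ)))

/-- Guessing probability of the ensemble that the POVM `P` on the first factor prepares on the
second factor. -/
def outputGuessProb {a b : Type*} [Fintype a] [Fintype b] [DecidableEq b]
    (ρ : Matrix (a × b) (a × b) ℂ) {n : ℕ} (P : Fin n → Matrix a a ℂ) : ℝ :=
  guessProb (fun i => outcomeProb ρ (P i)) (fun i => outcomeState ρ (P i))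

/-! ### The correlation measures -/

section Correlation

variable {a b : Type*} [Fintype a] [DecidableEq a] [Fintype b] [DecidableEq b]

/-- `C_A^{(n)}`. -/
def corrAn (n : ℕ) (ρ : Matrix (a × b) (a × b) ℂ) : ℝ :=
  sSup {g : ℝ | ∃ P : Fin n → Matrix a a ℂ,
    IsMEPOVM (traceSnd ρ) P ∧ g = outputGuessProb ρ P} - 1 / (n : ℝ)

/-- `C_A`: the number `n ≥ 2` of outputs is not fixed. -/
def corrA (ρ : Matrix (a × b) (a × b) ℂ) : ℝ :=
  sSup {g : ℝ | ∃ n : ℕ, 2 ≤ n ∧ ∃ P : Fin n → Matrix a a ℂ,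
    IsMEPOVM (traceSnd ρ) P ∧ g = outputGuessProb ρ P} - 1 / 2

/-- The same state with the two parties exchanged. -/
def swapState (ρ : Matrix (a × b) (a × b) ℂ) : Matrix (b × a) (b × a) ℂ :=
  ρ.submatrix Prod.swap Prod.swap

/-- `C_B^{(n)}`: the measured party is the second one. -/
def corrBn (n : ℕ) (ρ : Matrix (a × b) (a × b) ℂ) : ℝ := corrAn n (swapState ρ)

/-- `C_B`. -/
def corrB (ρ : Matrix (a × b) (a × b) ℂ) : ℝ := corrA (swapState ρ)

/-- `C^{(2)} = max {C_A^{(2)}, C_B^{(2)}}`. -/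
def corr2 (ρ : Matrix (a × b) (a × b) ℂ) : ℝ := max (corrAn 2 ρ) (corrBn 2 ρ)

/-- `C = max {C_A, C_B}`. -/
def corr (ρ : Matrix (a × b) (a × b) ℂ) : ℝ := max (corrA ρ) (corrB ρ)

end Correlation

/-! ### The probe -/

/-- `(|0⟩⟨0| ⊗ ρ' + |1⟩⟨1| ⊗ ρ'') / 2`, with a qubit as first factor. -/
def cqState {b : Type*} (ρ' ρ'' : Matrix b b ℂ) : Matrix (Fin 2 × b) (Fin 2 × b) ℂ :=
  (1 / 2 : ℂ) • (Matrix.single (0 : Fin 2) (0 : Fin 2) (1 : ℂ) ⊗ₖ ρ' +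
    Matrix.single (1 : Fin 2) (1 : Fin 2) (1 : ℂ) ⊗ₖ ρ'')

/-- The probe `ρ_AB(t)` at time `t`, with `B = A'S`, for the initial states `ρ'`, `ρ''` of `A'S`:
only `S` evolves, by `Λ t`. -/
def probe {A' S : Type*} (Λ : ℝ≥0 → OpMap S) (ρ' ρ'' : Matrix (A' × S) (A' × S) ℂ) (t : ℝ≥0) :
    Matrix (Fin 2 × (A' × S)) (Fin 2 × (A' × S)) ℂ :=
  cqState (idTensor A' (Λ t) ρ') (idTensor A' (Λ t) ρ'')

end

/-!
The statement reduces to three facts about finite-dimensional operators.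

*Values of the measures.* Let `σ₀`, `σ₁` be the states of `B` in the probe. A maximally entropic
measurement of the qubit gives outcome `i` the weights `a i` and `2 / n - a i` on `σ₀` and `σ₁`. If
`B` answers with the POVM `Q` and `R = ∑ a i • Q i`, the guessing score is
`1 / n + Re Tr ((σ₀ - σ₁) R) / 2`, and Helstrom's bound for the effect `R` gives
`‖σ₀ - σ₁‖₁ / 4 + 1 / 2` for all `n ≥ 2`, attained for `n = 2` (`corrA_cqState`). If `B` is measured
instead, with effects `P i`, a score is at most `1 / n + Tr (σ₀ (P j - P k)) / 2` for suitable `j`,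
`k`; the two-outcome measurement with effects `(1 ± (P j - P k)) / 2` does at least as well, and it
too is subject to Helstrom's bound (`corrB_cqState`). So `C^{(2)}` is a trace distance. It contracts
under completely positive trace preserving maps (`traceNorm_idTensor_le`), which is one direction of
every equivalence.

*Witnesses.* Let `Z` be a Hermitian operator on two copies of `S` such that `id ⊗ Λ τ` makes it
positive and `id ⊗ Λ s` does not. Mixed with enough of the identity, `Z` and a positive operator of
the same trace on one additional ancilla level give two states. At time `τ` their difference is a
multiple of a positive operator minus a positive operator of the same trace `t`, so its positive
part has at most that multiple of `t` as its trace; at time `s` the first operator has a negative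
eigenvalue, and as the second one lives on an orthogonal level the trace norm is strictly larger
(`traceNorm_lt_of_not_posSemidef`). If `Λ τ` is bijective, take for `Z` the preimage of the
maximally entangled state: at time `s` it has become the Choi matrix of the only intermediate map,
and `Z` does not depend on `s` (`exists_states_detecting`).

*Times at which the dynamics is not bijective.* If no witness `Z` exists, then `Λ s = V ∘ Λ τ` for
a linear `V`, and `Y ↦ ⟨Ω| (id ⊗ V)(Y) |Ω⟩`, with `Ω` the unnormalised maximally entangled vector,
is a positive functional on the range of `id ⊗ Λ τ`. By M. Riesz' theorem it extends to a positive
functional on all operators (`exists_positive_extension`), which is the functional of a completely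
positive `W` with `Λ s = W ∘ Λ τ` (`exists_cp_factor`). For a continuous dynamics, completely
positive intermediate maps from bijective times that converge to `τ` accumulate at one from `τ`, by
compactness (`exists_cptp_factor_of_tendsto`).
-/

namespace QInfo

open Matrix

/-! ### Positive semidefinite matrices and the trace norm -/

section LinearAlgebra

variable {a : Type*} [Fintype a] [DecidableEq a]

theorem trace_mul_nonneg {A B : Matrix a a ℂ} (hA : A.PosSemidef) (hB : B.PosSemidef) :
    0 ≤ (A * B).trace := by
  obtain ⟨C, rfl⟩ : ∃ C : Matrix a a ℂ, A = Cᴴ * C := by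
    open MatrixOrder in
    exact CStarAlgebra.nonneg_iff_eq_star_mul_self.mp hA.nonneg
  rw [Matrix.mul_assoc, Matrix.trace_mul_comm]
  exact (hB.mul_mul_conjTranspose_same C).trace_nonneg

theorem re_trace_mul_nonneg {A B : Matrix a a ℂ} (hA : A.PosSemidef) (hB : B.PosSemidef) :
    0 ≤ ((A * B).trace).re := (Complex.le_def.1 (trace_mul_nonneg hA hB)).1

theorem exists_unitary_diagonal {X : Matrix a a ℂ} (hX : X.IsHermitian) :
    ∃ U : Matrix a a ℂ, Uᴴ * U = 1 ∧ U * Uᴴ = 1 ∧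
      X = U * diagonal (fun i => (hX.eigenvalues i : ℂ)) * Uᴴ := by
  refine ⟨hX.eigenvectorUnitary, ?_, ?_, ?_⟩
  · exact Unitary.coe_star_mul_self hX.eigenvectorUnitary
  · exact Unitary.coe_mul_star_self hX.eigenvectorUnitary
  · conv_lhs => rw [hX.spectral_theorem]
    rfl

theorem exists_smul_one_add_posSemidef {H : Matrix a a ℂ} (hH : H.IsHermitian) :
    ∃ c : ℝ, 0 < c ∧ ((c : ℂ) • (1 : Matrix a a ℂ) + H).PosSemidef := by
  obtain ⟨U, -, hU, hX⟩ := exists_unitary_diagonal hH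
  refine ⟨1 + ∑ i, |hH.eigenvalues i|, by positivity, ?_⟩
  have h1 : (diagonal fun i => ((1 + ∑ i, |hH.eigenvalues i| + hH.eigenvalues i : ℝ) : ℂ)) =
      ((1 + ∑ i, |hH.eigenvalues i| : ℝ) : ℂ) • (1 : Matrix a a ℂ) +
        diagonal (fun i => (hH.eigenvalues i : ℂ)) := by
    ext i j
    by_cases h : i = j
    · subst h; simp
    · simp [h]
  have : ((1 + ∑ i, |hH.eigenvalues i| : ℝ) : ℂ) • (1 : Matrix a a ℂ) + H =
      U * diagonal (fun i => ((1 + ∑ i, |hH.eigenvalues i| + hH.eigenvalues i : ℝ) : ℂ)) * Uᴴ := by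
    rw [h1, Matrix.mul_add, Matrix.add_mul, ← hX, Matrix.mul_smul, Matrix.smul_mul,
      Matrix.mul_one, hU]
  rw [this]
  refine PosSemidef.mul_mul_conjTranspose_same (posSemidef_diagonal_iff.2 fun i => ?_) U
  have h2 := Finset.single_le_sum (f := fun i => |hH.eigenvalues i|)
    (fun j _ => abs_nonneg _) (Finset.mem_univ i)
  have h3 := neg_abs_le (hH.eigenvalues i)
  rw [Complex.zero_le_real]
  linarith

/-- A positive map preserves Hermiticity, a Hermitian operator being a difference of two positive
ones. -/
theorem positive_map_isHermitian {T : Matrix a a ℂ →ₗ[ℂ] Matrix a a ℂ}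
    (hT : ∀ X : Matrix a a ℂ, X.PosSemidef → (T X).PosSemidef) {A : Matrix a a ℂ}
    (hA : A.IsHermitian) : (T A).IsHermitian := by
  obtain ⟨c, hc, h⟩ := exists_smul_one_add_posSemidef hA
  have h1 := (hT _ h).1.sub (hT _ (PosSemidef.one.smul (Complex.zero_le_real.2 hc.le))).1
  rwa [← map_sub, add_sub_cancel_left] at h1

theorem re_trace_diag_conj (U Q : Matrix a a ℂ) (l : a → ℝ) :
    ((U * diagonal (fun i => (l i : ℂ)) * Uᴴ * Q).trace).re =
      ∑ i, l i * ((Uᴴ * Q * U) i i).re := by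
  rw [Matrix.mul_assoc, Matrix.trace_mul_comm, ← Matrix.mul_assoc, Matrix.trace_mul_comm]
  simp [Matrix.trace, Matrix.diagonal_mul]

theorem re_trace_mul_le_sum {X Q : Matrix a a ℂ} (hX : X.IsHermitian)
    (hQ : Q.PosSemidef) (hQ' : (1 - Q).PosSemidef) :
    ((X * Q).trace).re ≤ ∑ i, max (hX.eigenvalues i) 0 := by
  obtain ⟨U, hU, -, h⟩ := exists_unitary_diagonal hX
  conv_lhs => rw [h]
  rw [re_trace_diag_conj]
  refine Finset.sum_le_sum fun i _ => ?_
  have h0 : 0 ≤ ((Uᴴ * Q * U) i i).re :=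
    (Complex.le_def.1 ((hQ.conjTranspose_mul_mul_same U).diag_nonneg (i := i))).1
  have h1 : 0 ≤ ((Uᴴ * (1 - Q) * U) i i).re :=
    (Complex.le_def.1 ((hQ'.conjTranspose_mul_mul_same U).diag_nonneg (i := i))).1
  rw [Matrix.mul_sub, Matrix.sub_mul, Matrix.mul_one, hU] at h1
  simp only [Matrix.sub_apply, one_apply_eq, Complex.sub_re, Complex.one_re] at h1
  rcases le_total 0 (hX.eigenvalues i) with hl | hl
  · rw [max_eq_left hl]; nlinarith
  · rw [max_eq_right hl]; nlinarith

/-- The optimal effect is the spectral projection onto the nonnegative eigenvalues. -/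
theorem exists_effect_re_trace_eq_sum {X : Matrix a a ℂ} (hX : X.IsHermitian) :
    ∃ Q : Matrix a a ℂ, Q.PosSemidef ∧ (1 - Q).PosSemidef ∧
      ((X * Q).trace).re = ∑ i, max (hX.eigenvalues i) 0 := by
  obtain ⟨U, hU, hU', h⟩ := exists_unitary_diagonal hX
  set D : Matrix a a ℂ := diagonal (fun i => if 0 ≤ hX.eigenvalues i then 1 else 0) with hD
  refine ⟨U * D * Uᴴ, ?_, ?_, ?_⟩
  · refine PosSemidef.mul_mul_conjTranspose_same (posSemidef_diagonal_iff.2 fun i => ?_) U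
    split_ifs <;> simp
  · have : 1 - U * D * Uᴴ = U * (1 - D) * Uᴴ := by
      rw [Matrix.mul_sub, Matrix.sub_mul, Matrix.mul_one, hU']
    rw [this]
    refine PosSemidef.mul_mul_conjTranspose_same ?_ U
    rw [hD, ← diagonal_one, diagonal_sub]
    refine posSemidef_diagonal_iff.2 fun i => ?_
    split_ifs <;> simp
  · conv_lhs => rw [h]
    rw [re_trace_diag_conj]
    refine Finset.sum_congr rfl fun i _ => ?_
    have : Uᴴ * (U * D * Uᴴ) * U = D := by
      calc Uᴴ * (U * D * Uᴴ) * U = (Uᴴ * U) * D * (Uᴴ * U) := by simp only [Matrix.mul_assoc]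
        _ = D := by rw [hU]; simp
    rw [this, hD, diagonal_apply_eq]
    split_ifs with h1
    · simp [h1]
    · simp [(not_le.1 h1).le]

theorem trace_cfc {X : Matrix a a ℂ} (hX : X.IsHermitian) (f : ℝ → ℝ) :
    (cfc f X).trace = ∑ i, (f (hX.eigenvalues i) : ℂ) := by
  rw [hX.cfc_eq, IsHermitian.cfc, Unitary.conjStarAlgAut_apply, Matrix.trace_mul_cycle,
    Unitary.coe_star_mul_self, Matrix.one_mul, Matrix.trace_diagonal]
  rfl

/-- Both sides are the trace of `√(X²)`, computed from the eigenvalues of `Xᴴ * X` and of `X`. -/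
theorem traceNorm_eq_sum_abs {X : Matrix a a ℂ} (hX : X.IsHermitian) :
    traceNorm X = ∑ i, |hX.eigenvalues i| := by
  have h1 := trace_cfc (isHermitian_conjTranspose_mul_self X) Real.sqrt
  have h2 := trace_cfc hX (fun x => Real.sqrt (x ^ 2))
  have h3 : cfc (fun x : ℝ => Real.sqrt (x ^ 2)) X = cfc Real.sqrt (Xᴴ * X) := by
    rw [hX.eq, ← sq]
    exact cfc_comp_pow Real.sqrt 2 X (by fun_prop) hX
  rw [h3, h1] at h2
  simp only [Real.sqrt_sq_eq_abs] at h2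
  unfold traceNorm
  exact_mod_cast h2

theorem sum_max_eigenvalues {X : Matrix a a ℂ} (hX : X.IsHermitian) :
    ∑ i, max (hX.eigenvalues i) 0 = (traceNorm X + X.trace.re) / 2 := by
  have ht : X.trace.re = ∑ i, hX.eigenvalues i := by
    rw [hX.trace_eq_sum_eigenvalues, Complex.re_sum]; rfl
  rw [traceNorm_eq_sum_abs hX, ht, ← Finset.sum_add_distrib, Finset.sum_div]
  refine Finset.sum_congr rfl fun i _ => ?_
  rcases le_total 0 (hX.eigenvalues i) with hl | hl
  · rw [max_eq_left hl, abs_of_nonneg hl]; ring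
  · rw [max_eq_right hl, abs_of_nonpos hl]; ring

/-- Helstrom's bound. -/
theorem re_trace_mul_le_traceNorm {X Q : Matrix a a ℂ} (hX : X.IsHermitian)
    (ht : X.trace = 0) (hQ : Q.PosSemidef) (hQ' : (1 - Q).PosSemidef) :
    ((X * Q).trace).re ≤ traceNorm X / 2 := by
  have := re_trace_mul_le_sum hX hQ hQ'
  rwa [sum_max_eigenvalues, ht, Complex.zero_re, add_zero] at this

/-- Helstrom's bound is attained. -/
theorem exists_effect_traceNorm {X : Matrix a a ℂ} (hX : X.IsHermitian)
    (ht : X.trace = 0) : ∃ Q : Matrix a a ℂ, Q.PosSemidef ∧ (1 - Q).PosSemidef ∧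
      ((X * Q).trace).re = traceNorm X / 2 := by
  have := exists_effect_re_trace_eq_sum hX
  rwa [sum_max_eigenvalues, ht, Complex.zero_re, add_zero] at this

end LinearAlgebra

/-! ### Guessing probabilities of the ensembles prepared by a measurement -/

section Guess

variable {a b : Type*} [Fintype a] [DecidableEq a] [Fintype b] [DecidableEq b]

omit [DecidableEq a] in
theorem outcomeProb_eq (ρ : Matrix (a × b) (a × b) ℂ) (P : Matrix a a ℂ) :
    outcomeProb ρ P = ((traceSnd ρ * P).trace).re := by
  unfold outcomeProb traceSnd
  congr 1
  simp only [Matrix.trace, Matrix.diag_apply, Matrix.mul_apply, Fintype.sum_prod_type,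
    Matrix.kroneckerMap_apply, Matrix.one_apply, mul_ite, mul_one, mul_zero, Finset.sum_ite_eq',
    Finset.mem_univ, if_true, Matrix.of_apply, Finset.sum_mul]
  exact Finset.sum_congr rfl fun x _ => Finset.sum_comm

omit [DecidableEq a] in
theorem traceFst_mul_kronecker_one (ρ : Matrix (a × b) (a × b) ℂ) (P : Matrix a a ℂ) (i j : b) :
    traceFst (ρ * (P ⊗ₖ (1 : Matrix b b ℂ))) i j = ∑ x, ∑ y, ρ (x, i) (y, j) * P y x := by
  simp [traceFst, Matrix.mul_apply, Fintype.sum_prod_type, Matrix.one_apply]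

/-- The guessing score reached by the measurement `Q` on the second factor when it has to
identify the outcome of the measurement `P` on the first one. -/
noncomputable def score (ρ : Matrix (a × b) (a × b) ℂ) {n : ℕ} (P : Fin n → Matrix a a ℂ)
    (Q : Fin n → Matrix b b ℂ) : ℝ :=
  ∑ i, ((traceFst (ρ * (P i ⊗ₖ (1 : Matrix b b ℂ))) * Q i).trace).re

theorem outputGuessProb_eq {ρ : Matrix (a × b) (a × b) ℂ} {n : ℕ} {P : Fin n → Matrix a a ℂ}
    (hn : n ≠ 0) (hP : IsMEPOVM (traceSnd ρ) P) :
    outputGuessProb ρ P = sSup {g : ℝ | ∃ Q : Fin n → Matrix b b ℂ, IsPOVM Q ∧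
      g = score ρ P Q} := by
  unfold outputGuessProb guessProb score
  have hp : ∀ i, outcomeProb ρ (P i) = 1 / (n : ℝ) := fun i => by
    rw [outcomeProb_eq, hP.2 i]
    have : (1 / (n : ℂ)) = ((1 / (n : ℝ) : ℝ) : ℂ) := by push_cast; rfl
    rw [this, Complex.ofReal_re]
  have key : ∀ (i : Fin n) (Q : Matrix b b ℂ),
      outcomeProb ρ (P i) * ((outcomeState ρ (P i) * Q).trace).re =
        ((traceFst (ρ * (P i ⊗ₖ (1 : Matrix b b ℂ))) * Q).trace).re := by
    intro i Q
    have h0 : outcomeProb ρ (P i) ≠ 0 := by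
      rw [hp]; positivity
    unfold outcomeState
    rw [Matrix.smul_mul, Matrix.trace_smul, smul_eq_mul, ← Complex.ofReal_inv,
      Complex.re_ofReal_mul, mul_inv_cancel_left₀ h0]
  simp only [key]

theorem outputGuessProb_le {ρ : Matrix (a × b) (a × b) ℂ} {n : ℕ} {P : Fin n → Matrix a a ℂ}
    (hn : n ≠ 0) (hP : IsMEPOVM (traceSnd ρ) P) {M : ℝ} (hM : 0 ≤ M)
    (h : ∀ Q : Fin n → Matrix b b ℂ, IsPOVM Q → score ρ P Q ≤ M) :
    outputGuessProb ρ P ≤ M := by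
  rw [outputGuessProb_eq hn hP]
  refine Real.sSup_le ?_ hM
  rintro _ ⟨Q, hQ, rfl⟩
  exact h Q hQ

theorem le_outputGuessProb {ρ : Matrix (a × b) (a × b) ℂ} {n : ℕ} {P : Fin n → Matrix a a ℂ}
    (hn : n ≠ 0) (hP : IsMEPOVM (traceSnd ρ) P) {M : ℝ}
    (h : ∀ Q : Fin n → Matrix b b ℂ, IsPOVM Q → score ρ P Q ≤ M)
    {Q : Fin n → Matrix b b ℂ} (hQ : IsPOVM Q) :
    score ρ P Q ≤ outputGuessProb ρ P := by
  rw [outputGuessProb_eq hn hP]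
  refine le_csSup ⟨M, ?_⟩ ⟨Q, hQ, rfl⟩
  rintro _ ⟨Q, hQ, rfl⟩
  exact h Q hQ

/-- If no score exceeds `M`, and every score for `n` outcomes is matched by one for two
outcomes, then neither `C_A^{(2)}` nor `C_A` exceeds `M - 1 / 2` and the two agree. -/
theorem corrA_eq_corrAn_two {ρ : Matrix (a × b) (a × b) ℂ} {M : ℝ} (hM : 0 ≤ M)
    (hne : ∃ P : Fin 2 → Matrix a a ℂ, IsMEPOVM (traceSnd ρ) P)
    (hbound : ∀ (n : ℕ), 2 ≤ n → ∀ (P : Fin n → Matrix a a ℂ) (Q : Fin n → Matrix b b ℂ),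
      IsMEPOVM (traceSnd ρ) P → IsPOVM Q → score ρ P Q ≤ M)
    (htwo : ∀ (n : ℕ), 2 ≤ n → ∀ (P : Fin n → Matrix a a ℂ) (Q : Fin n → Matrix b b ℂ),
      IsMEPOVM (traceSnd ρ) P → IsPOVM Q →
      ∃ (P' : Fin 2 → Matrix a a ℂ) (Q' : Fin 2 → Matrix b b ℂ),
        IsMEPOVM (traceSnd ρ) P' ∧ IsPOVM Q' ∧ score ρ P Q ≤ score ρ P' Q') :
    corrA ρ = corrAn 2 ρ ∧ corrAn 2 ρ ≤ M - 1 / 2 ∧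
      ∀ (P : Fin 2 → Matrix a a ℂ) (Q : Fin 2 → Matrix b b ℂ),
        IsMEPOVM (traceSnd ρ) P → IsPOVM Q → score ρ P Q - 1 / 2 ≤ corrAn 2 ρ := by
  set A2 : Set ℝ := {g : ℝ | ∃ P : Fin 2 → Matrix a a ℂ,
    IsMEPOVM (traceSnd ρ) P ∧ g = outputGuessProb ρ P} with hA2
  set AA : Set ℝ := {g : ℝ | ∃ n : ℕ, 2 ≤ n ∧ ∃ P : Fin n → Matrix a a ℂ,
    IsMEPOVM (traceSnd ρ) P ∧ g = outputGuessProb ρ P} with hAA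
  have hAAb : ∀ g ∈ AA, g ≤ M := by
    rintro _ ⟨n, hn, P, hP, rfl⟩
    exact outputGuessProb_le (by omega) hP hM fun Q hQ => hbound n hn P Q hP hQ
  have hsub : A2 ⊆ AA := by
    rintro _ ⟨P, hP, rfl⟩
    exact ⟨2, le_rfl, P, hP, rfl⟩
  have hA2b : BddAbove A2 := ⟨M, fun g hg => hAAb g (hsub hg)⟩
  obtain ⟨P0, hP0⟩ := hne
  have hA2n : A2.Nonempty := ⟨_, P0, hP0, rfl⟩
  have hscore : ∀ (P : Fin 2 → Matrix a a ℂ) (Q : Fin 2 → Matrix b b ℂ),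
        IsMEPOVM (traceSnd ρ) P → IsPOVM Q → score ρ P Q ≤ sSup A2 := fun P Q hP hQ =>
    (le_outputGuessProb two_ne_zero hP (fun Q hQ => hbound 2 le_rfl P Q hP hQ) hQ).trans
      (le_csSup hA2b ⟨P, hP, rfl⟩)
  have hpos : 0 ≤ sSup A2 := by
    refine le_trans ?_ (hscore P0 (fun i => if i = 0 then 1 else 0) hP0
      ⟨fun i => by dsimp only; split_ifs <;> [exact .one; exact .zero], by simp⟩)
    -- with the guess always `0`, the score is the probability of that outcome
    have h1 : ((traceSnd ρ * P0 0).trace).re = 1 / 2 := by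
      rw [hP0.2 0]; norm_num
    have h2 : (∑ x, ∑ i, ∑ y, ρ (i, x) (y, x) * P0 0 y i).re = 1 / 2 := by
      rw [← h1]
      congr 1
      simp only [Matrix.trace, Matrix.diag_apply, Matrix.mul_apply, traceSnd, Matrix.of_apply,
        Finset.sum_mul]
      rw [Finset.sum_comm]
      exact Finset.sum_congr rfl fun x _ => Finset.sum_comm
    simp only [score, Fin.sum_univ_two, if_true, Matrix.mul_one]
    simp only [Matrix.trace, Matrix.diag_apply, traceFst_mul_kronecker_one, h2]
    norm_num
  have heq : sSup AA = sSup A2 := by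
    refine le_antisymm (Real.sSup_le ?_ hpos) (csSup_le_csSup ⟨M, hAAb⟩ hA2n hsub)
    rintro _ ⟨n, hn, P, hP, rfl⟩
    refine outputGuessProb_le (by omega) hP hpos fun Q hQ => ?_
    obtain ⟨P', Q', hP', hQ', hle⟩ := htwo n hn P Q hP hQ
    exact hle.trans (hscore P' Q' hP' hQ')
  have hc2 : corrAn 2 ρ = sSup A2 - 1 / 2 := by unfold corrAn; norm_num [hA2]
  refine ⟨?_, ?_, fun P Q hP hQ => ?_⟩
  · rw [hc2, ← heq, corrA]
  · rw [hc2]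
    exact sub_le_sub_right (csSup_le hA2n fun g hg => hAAb g (hsub hg)) _
  · rw [hc2]
    exact sub_le_sub_right (hscore P Q hP hQ) _

theorem one_sub_posSemidef {n : ℕ} {P : Fin n → Matrix a a ℂ} (hP : IsPOVM P) (i : Fin n) :
    (1 - P i).PosSemidef := by
  rw [← hP.2, ← Finset.sum_erase_add _ _ (Finset.mem_univ i), add_sub_cancel_right]
  exact posSemidef_sum _ fun j _ => hP.1 j

theorem isPOVM_pair {P : Matrix a a ℂ} (h : P.PosSemidef) (h' : (1 - P).PosSemidef) :
    IsPOVM ![P, 1 - P] := by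
  refine ⟨fun i => ?_, by simp [Fin.sum_univ_two]⟩
  fin_cases i <;> assumption

end Guess

/-! ### The correlation measures of a classical-quantum state -/

section ClassicalQuantum

variable {b : Type*} [Fintype b] [DecidableEq b] {σ₀ σ₁ : Matrix b b ℂ}

omit [Fintype b] [DecidableEq b] in
theorem cqState_apply (σ₀ σ₁ : Matrix b b ℂ) (x y : Fin 2) (i j : b) :
    cqState σ₀ σ₁ (x, i) (y, j) = if x = y then (1 / 2) * (if x = 0 then σ₀ i j else σ₁ i j)
      else 0 := by
  fin_cases x <;> fin_cases y <;> simp [cqState]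

omit [DecidableEq b] in
theorem traceSnd_cqState (h₀ : IsState σ₀) (h₁ : IsState σ₁) :
    traceSnd (cqState σ₀ σ₁) = (1 / 2 : ℂ) • (1 : Matrix (Fin 2) (Fin 2) ℂ) := by
  have e₀ : ∑ i, σ₀ i i = 1 := h₀.2
  have e₁ : ∑ i, σ₁ i i = 1 := h₁.2
  ext x y
  fin_cases x <;> fin_cases y <;>
    simp [traceSnd, cqState_apply, ← Finset.mul_sum, e₀, e₁]

theorem traceFst_cqState (σ₀ σ₁ : Matrix b b ℂ) (P : Matrix (Fin 2) (Fin 2) ℂ) :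
    traceFst (cqState σ₀ σ₁ * (P ⊗ₖ (1 : Matrix b b ℂ))) =
      (1 / 2 : ℂ) • (P 0 0 • σ₀ + P 1 1 • σ₁) := by
  ext i j
  rw [traceFst_mul_kronecker_one]
  simp [Fin.sum_univ_two, cqState_apply]
  ring

omit [Fintype b] [DecidableEq b] in
theorem traceSnd_swapState (σ₀ σ₁ : Matrix b b ℂ) :
    traceSnd (swapState (cqState σ₀ σ₁)) = (1 / 2 : ℂ) • (σ₀ + σ₁) := by
  ext i j
  simp [traceSnd, swapState, cqState_apply, Fin.sum_univ_two]
  ring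

omit [DecidableEq b] in
theorem traceFst_swapState (σ₀ σ₁ P : Matrix b b ℂ) :
    traceFst (swapState (cqState σ₀ σ₁) * (P ⊗ₖ (1 : Matrix (Fin 2) (Fin 2) ℂ))) =
      diagonal ![(1 / 2 : ℂ) * (σ₀ * P).trace, (1 / 2 : ℂ) * (σ₁ * P).trace] := by
  ext x y
  rw [traceFst_mul_kronecker_one]
  fin_cases x <;> fin_cases y <;>
    simp [swapState, cqState_apply, Matrix.trace, Matrix.mul_apply, Finset.mul_sum, mul_assoc]

theorem score_cqState (σ₀ σ₁ : Matrix b b ℂ) {n : ℕ} (P : Fin n → Matrix (Fin 2) (Fin 2) ℂ)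
    (Q : Fin n → Matrix b b ℂ) :
    score (cqState σ₀ σ₁) P Q =
      ((σ₀ * ∑ i, P i 0 0 • Q i).trace.re + (σ₁ * ∑ i, P i 1 1 • Q i).trace.re) / 2 := by
  unfold score
  rw [Matrix.mul_sum, Matrix.mul_sum, Matrix.trace_sum, Matrix.trace_sum, Complex.re_sum,
    Complex.re_sum, ← Finset.sum_add_distrib, Finset.sum_div]
  refine Finset.sum_congr rfl fun i _ => ?_
  rw [traceFst_cqState, Matrix.smul_mul, Matrix.add_mul, Matrix.trace_smul, Matrix.trace_add,
    Matrix.mul_smul, Matrix.mul_smul, Matrix.smul_mul, Matrix.smul_mul, smul_eq_mul,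
    ← Complex.add_re]
  have : (1 / 2 : ℂ) = ((1 / 2 : ℝ) : ℂ) := by push_cast; rfl
  rw [this, Complex.re_ofReal_mul]
  ring

theorem re_trace_sub_mul (h₀ : IsState σ₀) (h₁ : IsState σ₁) {Q : Matrix b b ℂ}
    (hQ : Q.PosSemidef) (hQ' : (1 - Q).PosSemidef) :
    (σ₀ * Q).trace.re - (σ₁ * Q).trace.re ≤ traceNorm (σ₀ - σ₁) / 2 := by
  have := re_trace_mul_le_traceNorm (h₀.1.1.sub h₁.1.1)
    (by rw [Matrix.trace_sub, h₀.2, h₁.2, sub_self]) hQ hQ'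
  rwa [Matrix.sub_mul, Matrix.trace_sub, Complex.sub_re] at this

/-- A measurement of the qubit only mixes the two states with weights that are bounded by the
probability `1 / n` of the outcomes, so Helstrom's bound applies to every number of outcomes. -/
theorem score_cqState_le (h₀ : IsState σ₀) (h₁ : IsState σ₁) {n : ℕ} (hn : 2 ≤ n)
    {P : Fin n → Matrix (Fin 2) (Fin 2) ℂ} {Q : Fin n → Matrix b b ℂ}
    (hP : IsMEPOVM (traceSnd (cqState σ₀ σ₁)) P) (hQ : IsPOVM Q) :
    score (cqState σ₀ σ₁) P Q ≤ traceNorm (σ₀ - σ₁) / 4 + 1 / 2 := by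
  rw [score_cqState]
  set R := ∑ i, P i 0 0 • Q i with hR
  have hsum : ∀ i, P i 1 1 = 2 / (n : ℂ) - P i 0 0 := by
    intro i
    have h := hP.2 i
    rw [traceSnd_cqState h₀ h₁, Matrix.smul_mul, Matrix.one_mul, Matrix.trace_smul,
      Matrix.trace_fin_two, smul_eq_mul] at h
    linear_combination 2 * h
  have hR1 : ∑ i, P i 1 1 • Q i = (2 / (n : ℂ)) • (1 : Matrix b b ℂ) - R := by
    rw [hR, ← hQ.2, Finset.smul_sum, ← Finset.sum_sub_distrib]
    exact Finset.sum_congr rfl fun i _ => by rw [hsum, sub_smul]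
  have hR0 : R.PosSemidef := posSemidef_sum _ fun i _ =>
    (hQ.1 i).smul (hP.1.1 i).diag_nonneg
  have hR2 : (1 - R).PosSemidef := by
    have : 1 - R = ∑ i, (1 - P i) 0 0 • Q i := by
      rw [hR, ← hQ.2, ← Finset.sum_sub_distrib]
      exact Finset.sum_congr rfl fun i _ => by simp [sub_smul]
    rw [this]
    exact posSemidef_sum _ fun i _ => (hQ.1 i).smul (one_sub_posSemidef hP.1 i).diag_nonneg
  have key := re_trace_sub_mul h₀ h₁ hR0 hR2
  have h2 : (σ₁ * ((2 / (n : ℂ)) • (1 : Matrix b b ℂ) - R)).trace.re =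
      2 / (n : ℝ) - (σ₁ * R).trace.re := by
    rw [Matrix.mul_sub, Matrix.trace_sub, Matrix.mul_smul, Matrix.mul_one, Matrix.trace_smul,
      h₁.2, smul_eq_mul, mul_one, Complex.sub_re]
    have : (2 / (n : ℂ)) = ((2 / (n : ℝ) : ℝ) : ℂ) := by push_cast; rfl
    rw [this, Complex.ofReal_re]
  have hn' : 2 / (n : ℝ) ≤ 1 := by
    rw [div_le_one (by positivity)]
    exact_mod_cast hn
  rw [hR1, h2]
  linarith

/-- The computational basis measurement of the qubit. -/
noncomputable def basisPOVM : Fin 2 → Matrix (Fin 2) (Fin 2) ℂ :=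
  ![Matrix.single 0 0 1, 1 - Matrix.single 0 0 1]

theorem isPOVM_basisPOVM : IsPOVM basisPOVM := by
  have h : ∀ i : Fin 2, (Matrix.single i i (1 : ℂ)).PosSemidef := fun i => by
    rw [← Matrix.diagonal_single]
    refine posSemidef_diagonal_iff.2 fun j => ?_
    by_cases hj : j = i
    · subst hj; simp
    · simp [hj]
  refine isPOVM_pair (h 0) ?_
  convert h 1
  ext i j
  fin_cases i <;> fin_cases j <;> simp

omit [DecidableEq b] in
theorem isMEPOVM_basisPOVM (h₀ : IsState σ₀) (h₁ : IsState σ₁) :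
    IsMEPOVM (traceSnd (cqState σ₀ σ₁)) basisPOVM := by
  refine ⟨isPOVM_basisPOVM, fun i => ?_⟩
  rw [traceSnd_cqState h₀ h₁]
  fin_cases i <;> norm_num [basisPOVM]

theorem exists_score_cqState_eq (h₀ : IsState σ₀) (h₁ : IsState σ₁) :
    ∃ Q : Fin 2 → Matrix b b ℂ, IsPOVM Q ∧
      score (cqState σ₀ σ₁) basisPOVM Q = traceNorm (σ₀ - σ₁) / 4 + 1 / 2 := by
  obtain ⟨Q, hQ, hQ', h⟩ := exists_effect_traceNorm (h₀.1.1.sub h₁.1.1)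
    (by rw [Matrix.trace_sub, h₀.2, h₁.2, sub_self])
  refine ⟨_, isPOVM_pair hQ hQ', ?_⟩
  rw [Matrix.sub_mul, Matrix.trace_sub, Complex.sub_re] at h
  rw [score_cqState]
  have e0 : ∑ i, basisPOVM i 0 0 • (![Q, 1 - Q] i) = Q := by
    simp [Fin.sum_univ_two, basisPOVM]
  have e1 : ∑ i, basisPOVM i 1 1 • (![Q, 1 - Q] i) = 1 - Q := by
    simp [Fin.sum_univ_two, basisPOVM]
  rw [e0, e1, Matrix.mul_sub, Matrix.mul_one, Matrix.trace_sub, h₁.2, Complex.sub_re,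
    Complex.one_re]
  linarith

theorem corrA_cqState (h₀ : IsState σ₀) (h₁ : IsState σ₁) :
    corrA (cqState σ₀ σ₁) = corrAn 2 (cqState σ₀ σ₁) ∧
      corrAn 2 (cqState σ₀ σ₁) = traceNorm (σ₀ - σ₁) / 4 := by
  obtain ⟨Q₀, hQ₀, hs⟩ := exists_score_cqState_eq h₀ h₁
  have hnn : 0 ≤ traceNorm (σ₀ - σ₁) := Finset.sum_nonneg fun i _ => Real.sqrt_nonneg _
  obtain ⟨h1, h2, h3⟩ := corrA_eq_corrAn_two (ρ := cqState σ₀ σ₁)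
    (M := traceNorm (σ₀ - σ₁) / 4 + 1 / 2) (by positivity)
    ⟨_, isMEPOVM_basisPOVM h₀ h₁⟩ (fun n hn P Q hP hQ => score_cqState_le h₀ h₁ hn hP hQ)
    (fun n hn P Q hP hQ => ⟨_, Q₀, isMEPOVM_basisPOVM h₀ h₁, hQ₀,
      (score_cqState_le h₀ h₁ hn hP hQ).trans_eq hs.symm⟩)
  refine ⟨h1, le_antisymm (by linarith) ?_⟩
  have := h3 _ Q₀ (isMEPOVM_basisPOVM h₀ h₁) hQ₀
  linarith

omit [DecidableEq b] in
theorem score_swapState (σ₀ σ₁ : Matrix b b ℂ) {n : ℕ} (P : Fin n → Matrix b b ℂ)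
    (Q : Fin n → Matrix (Fin 2) (Fin 2) ℂ) :
    score (swapState (cqState σ₀ σ₁)) P Q =
      (∑ i, ((σ₀ * P i).trace * Q i 0 0 + (σ₁ * P i).trace * Q i 1 1).re) / 2 := by
  unfold score
  rw [Finset.sum_div]
  refine Finset.sum_congr rfl fun i _ => ?_
  rw [traceFst_swapState]
  have : (1 / 2 : ℂ) = ((1 / 2 : ℝ) : ℂ) := by push_cast; rfl
  rw [Matrix.trace_fin_two, Matrix.diagonal_mul, Matrix.diagonal_mul]
  simp only [Matrix.cons_val_zero, Matrix.cons_val_one, mul_assoc]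
  rw [← mul_add, this, Complex.re_ofReal_mul]
  ring

theorem re_mul_of_nonneg {x y : ℂ} (hx : 0 ≤ x) : (x * y).re = x.re * y.re := by
  rw [Complex.mul_re, ← (Complex.le_def.1 hx).2]
  simp

theorem re_trace_add {n : ℕ} {P : Fin n → Matrix b b ℂ}
    (hP : IsMEPOVM (traceSnd (swapState (cqState σ₀ σ₁))) P) (i : Fin n) :
    (σ₀ * P i).trace.re + (σ₁ * P i).trace.re = 2 / n := by
  have h := hP.2 i
  rw [traceSnd_swapState, Matrix.smul_mul, Matrix.add_mul, Matrix.trace_smul, Matrix.trace_add,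
    smul_eq_mul] at h
  have h' : (σ₀ * P i).trace + (σ₁ * P i).trace = ((2 / n : ℝ) : ℂ) := by
    push_cast
    linear_combination 2 * h
  rw [← Complex.add_re, h', Complex.ofReal_re]

/-- A score obtained by measuring the second party is at most the one in which the qubit is
measured in the computational basis and each basis state is answered by the outcome it makes
most likely. -/
theorem exists_score_swapState_le (h₀ : IsState σ₀) (h₁ : IsState σ₁) {n : ℕ} (hn : 2 ≤ n)
    {P : Fin n → Matrix b b ℂ} {Q : Fin n → Matrix (Fin 2) (Fin 2) ℂ}
    (hP : IsMEPOVM (traceSnd (swapState (cqState σ₀ σ₁))) P) (hQ : IsPOVM Q) :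
    ∃ j k : Fin n, score (swapState (cqState σ₀ σ₁)) P Q ≤
      1 / n + ((σ₀ * P j).trace.re - (σ₀ * P k).trace.re) / 2 := by
  set s : Fin n → ℝ := fun i => (σ₀ * P i).trace.re with hs
  have : Nonempty (Fin n) := ⟨⟨0, by omega⟩⟩
  obtain ⟨j, hj⟩ := Finite.exists_max s
  obtain ⟨k, hk⟩ := Finite.exists_min s
  refine ⟨j, k, ?_⟩
  have hu : ∀ x : Fin 2, ∑ i, (Q i x x).re = 1 := fun x => by
    have := congrFun (congrFun hQ.2 x) x
    rw [Matrix.sum_apply, Matrix.one_apply_eq] at this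
    rw [← Complex.re_sum, this, Complex.one_re]
  have hQn : ∀ i x, 0 ≤ (Q i x x).re := fun i x =>
    (Complex.le_def.1 (hQ.1 i).diag_nonneg).1
  rw [score_swapState]
  have e : ∀ i, ((σ₀ * P i).trace * Q i 0 0 + (σ₁ * P i).trace * Q i 1 1).re ≤
      s j * (Q i 0 0).re + (2 / n - s k) * (Q i 1 1).re := fun i => by
    rw [Complex.add_re, re_mul_of_nonneg (trace_mul_nonneg h₀.1 (hP.1.1 i)),
      re_mul_of_nonneg (trace_mul_nonneg h₁.1 (hP.1.1 i))]
    have h := re_trace_add hP i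
    refine add_le_add (mul_le_mul_of_nonneg_right (hj i) (hQn i 0))
      (mul_le_mul_of_nonneg_right ?_ (hQn i 1))
    have := hk i
    simp only [hs] at this ⊢
    linarith
  have := Finset.sum_le_sum fun i (_ : i ∈ Finset.univ) => e i
  rw [Finset.sum_add_distrib, ← Finset.mul_sum, ← Finset.mul_sum, hu, hu] at this
  have hn2 : (2 / n : ℝ) = 2 * (1 / n) := by ring
  rw [hn2] at this
  change _ ≤ 1 / (n : ℝ) + (s j - s k) / 2
  linarith

/-- The bound `1 / n + Tr (σ₀ (P j - P k)) / 2` obeys Helstrom's bound as well: for a maximally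
entropic measurement, `Tr (σ₀ (P j - P k))` is half of `Tr ((σ₀ - σ₁) (P j - P k))`. -/
theorem score_swapState_le (h₀ : IsState σ₀) (h₁ : IsState σ₁) {n : ℕ} (hn : 2 ≤ n)
    {P : Fin n → Matrix b b ℂ} {Q : Fin n → Matrix (Fin 2) (Fin 2) ℂ}
    (hP : IsMEPOVM (traceSnd (swapState (cqState σ₀ σ₁))) P) (hQ : IsPOVM Q) :
    score (swapState (cqState σ₀ σ₁)) P Q ≤ traceNorm (σ₀ - σ₁) / 4 + 1 / 2 := by
  obtain ⟨j, k, h⟩ := exists_score_swapState_le h₀ h₁ hn hP hQ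
  have hj := re_trace_add hP j
  have hk := re_trace_add hP k
  have tj := re_trace_sub_mul h₀ h₁ (hP.1.1 j) (one_sub_posSemidef hP.1 j)
  have tk := re_trace_sub_mul h₀ h₁ (Q := 1 - P k) (one_sub_posSemidef hP.1 k)
    (by rw [sub_sub_cancel]; exact hP.1.1 k)
  simp only [Matrix.mul_sub, Matrix.mul_one, Matrix.trace_sub, h₀.2, h₁.2, Complex.sub_re] at tk
  have hn' : 1 / (n : ℝ) ≤ 1 / 2 :=
    one_div_le_one_div_of_le (by norm_num) (by exact_mod_cast hn)
  linarith

/-- Two outcomes suffice for the second party: the outcomes `j` and `k` of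
`exists_score_swapState_le` are kept, and all others are assigned to one of them by a fair coin. -/
theorem exists_two_outcome_swapState (h₀ : IsState σ₀) (h₁ : IsState σ₁) {n : ℕ} (hn : 2 ≤ n)
    {P : Fin n → Matrix b b ℂ} {Q : Fin n → Matrix (Fin 2) (Fin 2) ℂ}
    (hP : IsMEPOVM (traceSnd (swapState (cqState σ₀ σ₁))) P) (hQ : IsPOVM Q) :
    ∃ (P' : Fin 2 → Matrix b b ℂ) (Q' : Fin 2 → Matrix (Fin 2) (Fin 2) ℂ),
      IsMEPOVM (traceSnd (swapState (cqState σ₀ σ₁))) P' ∧ IsPOVM Q' ∧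
      score (swapState (cqState σ₀ σ₁)) P Q ≤ score (swapState (cqState σ₀ σ₁)) P' Q' := by
  obtain ⟨j, k, h⟩ := exists_score_swapState_le h₀ h₁ hn hP hQ
  have half : (0 : ℂ) ≤ 1 / 2 := by
    rw [Complex.le_def]; norm_num
  have psd : ∀ j k, ((1 / 2 : ℂ) • (P j + (1 - P k))).PosSemidef := fun j k =>
    ((hP.1.1 j).add (one_sub_posSemidef hP.1 k)).smul half
  have compl : 1 - (1 / 2 : ℂ) • (P j + (1 - P k)) = (1 / 2 : ℂ) • (P k + (1 - P j)) := by
    module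
  have hME : ∀ j k, (traceSnd (swapState (cqState σ₀ σ₁)) *
      (1 / 2 : ℂ) • (P j + (1 - P k))).trace = 1 / 2 := fun j k => by
    rw [Matrix.mul_smul, Matrix.mul_add, Matrix.mul_sub, Matrix.mul_one, Matrix.trace_smul,
      Matrix.trace_add, Matrix.trace_sub, hP.2, hP.2, traceSnd_swapState, Matrix.trace_smul,
      Matrix.trace_add, h₀.2, h₁.2]
    norm_num
  refine ⟨![(1 / 2 : ℂ) • (P j + (1 - P k)), 1 - (1 / 2 : ℂ) • (P j + (1 - P k))], basisPOVM,
    ⟨isPOVM_pair (psd j k) (compl ▸ psd k j), fun i => ?_⟩, isPOVM_basisPOVM, ?_⟩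
  · fin_cases i
    · simpa using hME j k
    · simp only [Fin.mk_one, Matrix.cons_val_one, Matrix.cons_val_zero]
      rw [compl]
      simpa using hME k j
  · refine h.trans ?_
    rw [score_swapState, Fin.sum_univ_two]
    have hj := re_trace_add hP j
    have hk := re_trace_add hP k
    simp only [Matrix.cons_val_one, Matrix.cons_val_zero]
    rw [compl]
    have e0 : basisPOVM 0 0 0 = 1 := by simp [basisPOVM]
    have e1 : basisPOVM 0 1 1 = 0 := by simp [basisPOVM]
    have e2 : basisPOVM 1 0 0 = 0 := by simp [basisPOVM]
    have e3 : basisPOVM 1 1 1 = 1 := by simp [basisPOVM]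
    have half' : (1 / 2 : ℂ) = ((1 / 2 : ℝ) : ℂ) := by push_cast; rfl
    rw [e0, e1, e2, e3]
    simp only [mul_one, mul_zero, add_zero, zero_add, Matrix.mul_smul, Matrix.trace_smul,
      smul_eq_mul, half', Complex.re_ofReal_mul, Matrix.mul_add, Matrix.mul_sub,
      Matrix.trace_add, Matrix.trace_sub, h₀.2, h₁.2, Complex.add_re, Complex.sub_re,
      Complex.one_re]
    have hn' : 1 / (n : ℝ) ≤ 1 / 2 :=
      one_div_le_one_div_of_le (by norm_num) (by exact_mod_cast hn)
    linarith

theorem corrB_cqState (h₀ : IsState σ₀) (h₁ : IsState σ₁) :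
    corrB (cqState σ₀ σ₁) = corrBn 2 (cqState σ₀ σ₁) ∧
      corrBn 2 (cqState σ₀ σ₁) ≤ traceNorm (σ₀ - σ₁) / 4 := by
  have hnn : 0 ≤ traceNorm (σ₀ - σ₁) := Finset.sum_nonneg fun i _ => Real.sqrt_nonneg _
  have half : (0 : ℂ) ≤ 1 / 2 := by
    rw [Complex.le_def]; norm_num
  have hhalf : IsMEPOVM (traceSnd (swapState (cqState σ₀ σ₁)))
      (fun _ : Fin 2 => (1 / 2 : ℂ) • (1 : Matrix b b ℂ)) := by
    refine ⟨⟨fun _ => PosSemidef.one.smul half, ?_⟩, fun _ => ?_⟩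
    · rw [Fin.sum_univ_two]; module
    · rw [traceSnd_swapState, Matrix.mul_smul, Matrix.mul_one, Matrix.trace_smul,
        Matrix.trace_smul, Matrix.trace_add, h₀.2, h₁.2]
      norm_num
  obtain ⟨h1, h2, -⟩ := corrA_eq_corrAn_two (ρ := swapState (cqState σ₀ σ₁))
    (M := traceNorm (σ₀ - σ₁) / 4 + 1 / 2) (by positivity) ⟨_, hhalf⟩
    (fun n hn P Q hP hQ => score_swapState_le h₀ h₁ hn hP hQ)
    (fun n hn P Q hP hQ => exists_two_outcome_swapState h₀ h₁ hn hP hQ)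
  exact ⟨h1, by unfold corrBn; linarith⟩

/-- `C^{(2)}` of a classical-quantum state is the trace distance of its two components, up to
the factor `1 / 2`. -/
theorem corr2_cqState (h₀ : IsState σ₀) (h₁ : IsState σ₁) :
    corr2 (cqState σ₀ σ₁) = traceNorm (σ₀ - σ₁) / 4 := by
  unfold corr2
  rw [(corrA_cqState h₀ h₁).2]
  exact max_eq_left (corrB_cqState h₀ h₁).2

end ClassicalQuantum

/-! ### Complete positivity -/

section CompletePositivity

/-- Over `ℂ`, Hermiticity follows from the quadratic form being real. -/
theorem posSemidef_of_forall_nonneg {n : Type*} [Fintype n] [DecidableEq n] {M : Matrix n n ℂ}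
    (h : ∀ x : n → ℂ, 0 ≤ star x ⬝ᵥ (M *ᵥ x)) : M.PosSemidef := by
  have hstar : ∀ x : n → ℂ, star x ⬝ᵥ (Mᴴ *ᵥ x) = star x ⬝ᵥ (M *ᵥ x) := fun x => by
    have h1 : star (star x ⬝ᵥ (M *ᵥ x)) = star x ⬝ᵥ (Mᴴ *ᵥ x) := by
      rw [← Matrix.star_dotProduct_star, star_star, Matrix.star_mulVec,
        ← Matrix.dotProduct_mulVec]
    rw [← h1]
    exact (IsSelfAdjoint.of_nonneg (h x))
  -- `i (M - Mᴴ)` is Hermitian with vanishing quadratic form, hence zero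
  have hK : (Complex.I • (M - Mᴴ)).PosSemidef := by
    refine PosSemidef.of_dotProduct_mulVec_nonneg ?_ fun x => ?_
    · unfold IsHermitian
      rw [conjTranspose_smul, conjTranspose_sub, conjTranspose_conjTranspose]
      simp only [RCLike.star_def, Complex.conj_I]
      module
    · rw [Matrix.smul_mulVec, dotProduct_smul, Matrix.sub_mulVec, dotProduct_sub, hstar]
      simp
  have h0 : Complex.I • (M - Mᴴ) = 0 := by
    rw [← hK.trace_eq_zero_iff, Matrix.trace]
    refine Finset.sum_eq_zero fun i _ => ?_
    have := hstar (Pi.single i 1)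
    simp only [Pi.star_single, star_one, single_one_dotProduct, mulVec_single_one, col_apply]
      at this
    simp only [Matrix.diag_apply, Matrix.smul_apply, Matrix.sub_apply, this]
    simp
  have h1 : M = Mᴴ := by
    rw [smul_eq_zero] at h0
    exact sub_eq_zero.1 (h0.resolve_left Complex.I_ne_zero)
  exact .of_dotProduct_mulVec_nonneg h1.symm h

variable {S k : Type*}

/-- The block of `X` at position `(x, y)`. -/
def block (X : Matrix (k × S) (k × S) ℂ) (x y : k) : Matrix S S ℂ :=
  Matrix.of fun i j => X (x, i) (y, j)

theorem idTensor_apply (Φ : OpMap S) (X : Matrix (k × S) (k × S) ℂ) (p q : k × S) :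
    idTensor k Φ X p q = Φ (block X p.1 q.1) p.2 q.2 := rfl

/-- `id ⊗ Φ` as a linear map. -/
def idTensorₗ (k : Type*) (Φ : OpMap S) :
    Matrix (k × S) (k × S) ℂ →ₗ[ℂ] Matrix (k × S) (k × S) ℂ where
  toFun := idTensor k Φ
  map_add' X Y := by
    ext p q
    rw [Matrix.add_apply, idTensor_apply, idTensor_apply, idTensor_apply, ← Matrix.add_apply,
      ← map_add]
    rfl
  map_smul' c X := by
    ext p q
    rw [Matrix.smul_apply, idTensor_apply, idTensor_apply, RingHom.id_apply, ← Matrix.smul_apply,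
      ← map_smul]
    rfl

@[simp] theorem idTensorₗ_apply (Φ : OpMap S) (X : Matrix (k × S) (k × S) ℂ) :
    idTensorₗ k Φ X = idTensor k Φ X := rfl

theorem idTensor_sub (Φ : OpMap S) (X Y : Matrix (k × S) (k × S) ℂ) :
    idTensor k Φ (X - Y) = idTensor k Φ X - idTensor k Φ Y := map_sub (idTensorₗ k Φ) X Y

theorem idTensor_smul (Φ : OpMap S) (c : ℂ) (X : Matrix (k × S) (k × S) ℂ) :
    idTensor k Φ (c • X) = c • idTensor k Φ X := map_smul (idTensorₗ k Φ) c X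

theorem idTensor_comp (Φ Ψ : OpMap S) (X : Matrix (k × S) (k × S) ℂ) :
    idTensor k (Φ ∘ₗ Ψ) X = idTensor k Φ (idTensor k Ψ X) := rfl

variable [Fintype S]

/-- The ancilla may be indexed by any finite type. -/
theorem idTensor_posSemidef [Fintype k] {Φ : OpMap S} (hΦ : IsCP Φ)
    {X : Matrix (k × S) (k × S) ℂ} (hX : X.PosSemidef) : (idTensor k Φ X).PosSemidef := by
  let e := Fintype.equivFin k
  exact (hΦ _ _ (hX.submatrix (Prod.map e.symm id))).submatrix (Prod.map e id) |> fun h => by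
    convert h using 1
    ext p q
    simp [idTensor]

theorem trace_idTensor [Fintype k] {Φ : OpMap S} (hΦ : IsTP Φ) (X : Matrix (k × S) (k × S) ℂ) :
    (idTensor k Φ X).trace = X.trace := by
  simp only [Matrix.trace, Matrix.diag_apply, Fintype.sum_prod_type]
  exact Finset.sum_congr rfl fun x _ => hΦ (block X x x)

theorem isState_idTensor [Fintype k] {Φ : OpMap S} (hΦ : IsCP Φ) (hΦ' : IsTP Φ)
    {ρ : Matrix (k × S) (k × S) ℂ} (hρ : IsState ρ) : IsState (idTensor k Φ ρ) :=
  ⟨idTensor_posSemidef hΦ hρ.1, (trace_idTensor hΦ' ρ).trans hρ.2⟩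

theorem map_posSemidef {Φ : OpMap S} (hΦ : IsCP Φ) {X : Matrix S S ℂ} (hX : X.PosSemidef) :
    (Φ X).PosSemidef :=
  (idTensor_posSemidef (k := Unit) hΦ (hX.submatrix Prod.snd)).submatrix fun i => ((), i)

variable [DecidableEq S]

theorem map_isHermitian {Φ : OpMap S} (hΦ : IsCP Φ) {X : Matrix S S ℂ} (hX : X.IsHermitian) :
    (Φ X).IsHermitian :=
  positive_map_isHermitian (fun _ h => map_posSemidef hΦ h) hX

theorem exists_hermitian_decomp {n : Type*} (X : Matrix n n ℂ) :
    ∃ A B : Matrix n n ℂ, A.IsHermitian ∧ B.IsHermitian ∧ X = A + Complex.I • B ∧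
      Xᴴ = A - Complex.I • B := by
  refine ⟨(1 / 2 : ℂ) • (X + Xᴴ), (-Complex.I / 2) • (X - Xᴴ), ?_, ?_, ?_, ?_⟩
  · unfold IsHermitian
    rw [conjTranspose_smul, conjTranspose_add, conjTranspose_conjTranspose, add_comm]
    simp
  · unfold IsHermitian
    rw [conjTranspose_smul, conjTranspose_sub, conjTranspose_conjTranspose]
    simp only [star_div₀, star_neg, RCLike.star_def, Complex.conj_I, map_ofNat]
    module
  · rw [smul_smul]
    have : Complex.I * (-Complex.I / 2) = 1 / 2 := by
      rw [mul_div_assoc', mul_neg, Complex.I_mul_I]; norm_num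
    rw [this]; module
  · rw [smul_smul]
    have : Complex.I * (-Complex.I / 2) = 1 / 2 := by
      rw [mul_div_assoc', mul_neg, Complex.I_mul_I]; norm_num
    rw [this]; module

theorem map_conjTranspose {Φ : OpMap S} (hΦ : IsCP Φ) (X : Matrix S S ℂ) :
    Φ Xᴴ = (Φ X)ᴴ := by
  obtain ⟨A, B, hA, hB, h, h'⟩ := exists_hermitian_decomp X
  rw [h', h, map_sub, map_add, map_smul, conjTranspose_add, conjTranspose_smul,
    (map_isHermitian hΦ hA).eq, (map_isHermitian hΦ hB).eq]
  simp [sub_eq_add_neg]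

theorem idTensor_conjTranspose {Φ : OpMap S} (hΦ : IsCP Φ) (X : Matrix (k × S) (k × S) ℂ) :
    idTensor k Φ Xᴴ = (idTensor k Φ X)ᴴ := by
  ext p q
  have : block Xᴴ p.1 q.1 = (block X q.1 p.1)ᴴ := rfl
  rw [idTensor_apply, this, map_conjTranspose hΦ]
  rfl

theorem idTensor_isHermitian {Φ : OpMap S} (hΦ : IsCP Φ) {X : Matrix (k × S) (k × S) ℂ}
    (hX : X.IsHermitian) : (idTensor k Φ X).IsHermitian := by
  unfold IsHermitian
  rw [← idTensor_conjTranspose hΦ, hX.eq]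

omit [DecidableEq S] in
/-- The functional `⟨Ω| (id ⊗ Φ)(X) |Ω⟩` with the unnormalised maximally entangled vector
`Ω = ∑ k, |k⟩ ⊗ |k⟩`. -/
def entangledForm (Φ : OpMap S) (X : Matrix (S × S) (S × S) ℂ) : ℂ :=
  ∑ x, ∑ y, idTensor S Φ X (x, x) (y, y)

/-- A map is completely positive as soon as the functional `⟨Ω| (id ⊗ Φ)(·) |Ω⟩` is positive:
every quadratic form of `(id ⊗ Φ)(X)` is a value of that functional at a congruence of `X`. -/
theorem isCP_of_entangledForm_nonneg {Φ : OpMap S}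
    (h : ∀ X : Matrix (S × S) (S × S) ℂ, X.PosSemidef → 0 ≤ entangledForm Φ X) : IsCP Φ := by
  intro n X hX
  refine posSemidef_of_forall_nonneg fun v => ?_
  -- `B` sends `|y⟩ ⊗ |j⟩` to `(∑ a, v (a, y) |a⟩) ⊗ |j⟩`
  set B : Matrix (Fin n × S) (S × S) ℂ :=
    Matrix.of fun p q => if p.2 = q.2 then v (p.1, q.1) else 0 with hB
  have hY := h _ (hX.conjTranspose_mul_mul_same B)
  convert hY using 1
  have hblock : ∀ x y, block (Bᴴ * X * B) x y =
      ∑ a, ∑ b, (star (v (a, x)) * v (b, y)) • block X a b := by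
    intro x y
    ext i j
    simp only [Matrix.sum_apply, Matrix.smul_apply, smul_eq_mul]
    change (Bᴴ * X * B) (x, i) (y, j) = ∑ a, ∑ b, star (v (a, x)) * v (b, y) * X (a, i) (b, j)
    simp only [Matrix.mul_apply, Matrix.conjTranspose_apply, Fintype.sum_prod_type, hB,
      Matrix.of_apply, apply_ite star, star_zero, ite_mul, mul_ite, zero_mul, mul_zero,
      Finset.sum_ite_eq', Finset.mem_univ, if_true, Finset.sum_mul]
    rw [Finset.sum_comm]
    exact Finset.sum_congr rfl fun a _ => Finset.sum_congr rfl fun b _ => by ring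
  simp only [entangledForm, idTensor_apply, hblock, map_sum, map_smul, Matrix.sum_apply,
    Matrix.smul_apply, smul_eq_mul]
  simp only [dotProduct, mulVec, Fintype.sum_prod_type, Pi.star_apply, idTensor_apply,
    Finset.mul_sum]
  rw [Finset.sum_comm]
  refine Finset.sum_congr rfl fun x _ => ?_
  rw [Finset.sum_congr rfl fun a _ => Finset.sum_comm, Finset.sum_comm]
  refine Finset.sum_congr rfl fun y _ => Finset.sum_congr rfl fun a _ =>
    Finset.sum_congr rfl fun b _ => ?_
  ring

/-- The projector onto the maximally entangled vector, scaled to trace `dim S`. -/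
def entangledState (S : Type*) [DecidableEq S] : Matrix (S × S) (S × S) ℂ :=
  Matrix.of fun p q => if p.1 = p.2 ∧ q.1 = q.2 then 1 else 0

theorem entangledState_posSemidef : (entangledState S).PosSemidef := by
  have : entangledState S = vecMulVec (fun p => if p.1 = p.2 then 1 else 0)
      (star fun p => if p.1 = p.2 then 1 else 0) := by
    ext p q
    simp only [entangledState, Matrix.of_apply, vecMulVec_apply, Pi.star_apply]
    by_cases h : p.1 = p.2 <;> by_cases h' : q.1 = q.2 <;> simp [h, h']
  rw [this]
  exact posSemidef_vecMulVec_self_star _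

omit [Fintype S] in
theorem block_entangledState (i j : S) : block (entangledState S) i j = Matrix.single i j 1 := by
  ext p q
  simp [block, entangledState, Matrix.single_apply]

/-- Choi's criterion. -/
theorem isCP_of_choi {Φ : OpMap S} (h : (idTensor S Φ (entangledState S)).PosSemidef) :
    IsCP Φ := by
  refine isCP_of_entangledForm_nonneg fun X hX => ?_
  -- the functional is the trace of the Choi matrix against the transpose of `X`, with the two
  -- factors exchanged
  have h1 := trace_mul_nonneg (hX.transpose.submatrix Prod.swap) h
  convert h1 using 1
  have hdecomp : ∀ x y, block X x y = ∑ i, ∑ j, X (x, i) (y, j) • Matrix.single i j (1 : ℂ) := by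
    intro x y
    rw [matrix_eq_sum_single (block X x y)]
    simp [block]
  simp only [entangledForm, idTensor_apply, Matrix.trace, Matrix.diag_apply, Matrix.mul_apply,
    Fintype.sum_prod_type, block_entangledState, hdecomp, map_sum, map_smul, Matrix.sum_apply,
    Matrix.smul_apply, smul_eq_mul, Matrix.submatrix_apply, Matrix.transpose_apply,
    Prod.swap_prod_mk]
  rw [Finset.sum_congr rfl fun x _ => (Finset.sum_congr rfl fun y _ => Finset.sum_comm).trans
    Finset.sum_comm, Finset.sum_comm]
  exact Finset.sum_congr rfl fun j _ => Finset.sum_comm.trans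
    (Finset.sum_congr rfl fun y _ => Finset.sum_comm)

end CompletePositivity

/-! ### Contraction of the trace norm -/

section Contraction

/-- The Jordan decomposition into positive and negative part. -/
theorem exists_jordan {a : Type*} [Fintype a] [DecidableEq a] {X : Matrix a a ℂ}
    (hX : X.IsHermitian) (ht : X.trace = 0) :
    ∃ A B : Matrix a a ℂ, A.PosSemidef ∧ B.PosSemidef ∧ X = A - B ∧
      A.trace.re = traceNorm X / 2 := by
  have hs := sum_max_eigenvalues hX
  rw [ht, Complex.zero_re, add_zero] at hs
  obtain ⟨U, hU, -, h⟩ := exists_unitary_diagonal hX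
  refine ⟨U * diagonal (fun i => ((max (hX.eigenvalues i) 0 : ℝ) : ℂ)) * Uᴴ,
    U * diagonal (fun i => ((max (-hX.eigenvalues i) 0 : ℝ) : ℂ)) * Uᴴ,
    PosSemidef.mul_mul_conjTranspose_same (posSemidef_diagonal_iff.2 fun i =>
      Complex.zero_le_real.2 (le_max_right _ _)) U,
    PosSemidef.mul_mul_conjTranspose_same (posSemidef_diagonal_iff.2 fun i =>
      Complex.zero_le_real.2 (le_max_right _ _)) U, ?_, ?_⟩
  · conv_lhs => rw [h]
    rw [← Matrix.sub_mul, ← Matrix.mul_sub, diagonal_sub]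
    congr 3
    funext i
    rw [← Complex.ofReal_sub]
    congr 1
    rcases le_total 0 (hX.eigenvalues i) with hl | hl
    · rw [max_eq_left hl, max_eq_right (by linarith)]; ring
    · rw [max_eq_right hl, max_eq_left (by linarith)]; ring
  · rw [← hs, Matrix.trace_mul_cycle, hU, Matrix.one_mul, Matrix.trace_diagonal, Complex.re_sum]
    rfl

theorem re_trace_mul_le_re_trace {a : Type*} [Fintype a] [DecidableEq a] {A Q : Matrix a a ℂ}
    (hA : A.PosSemidef) (hQ : (1 - Q).PosSemidef) : (A * Q).trace.re ≤ A.trace.re := by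
  have := re_trace_mul_nonneg hA hQ
  rw [Matrix.mul_sub, Matrix.mul_one, Matrix.trace_sub, Complex.sub_re] at this
  linarith

variable {S k : Type*} [Fintype S] [DecidableEq S] [Fintype k] [DecidableEq k]

theorem traceNorm_idTensor_le {V : OpMap S} (hV : IsCP V) (hV' : IsTP V)
    {X : Matrix (k × S) (k × S) ℂ} (hX : X.IsHermitian) (ht : X.trace = 0) :
    traceNorm (idTensor k V X) ≤ traceNorm X := by
  obtain ⟨A, B, hA, hB, rfl, hAt⟩ := exists_jordan hX ht
  obtain ⟨Q, hQ, hQ', h⟩ := exists_effect_traceNorm (idTensor_isHermitian hV hX)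
    ((trace_idTensor hV' _).trans ht)
  have h1 := re_trace_mul_le_re_trace (idTensor_posSemidef hV hA) hQ'
  have h2 := re_trace_mul_nonneg (idTensor_posSemidef hV hB) hQ
  rw [trace_idTensor hV'] at h1
  rw [idTensor_sub V A B, Matrix.sub_mul, Matrix.trace_sub, Complex.sub_re,
    ← idTensor_sub V A B] at h
  linarith

end Contraction

/-! ### A pair of states that witnesses the loss of positivity -/

section Witness

variable {S : Type*}

/-- The operator `Z` on the first `dim S` levels of the ancilla, extended by zero to the
additional level `none`. -/
def embed (Z : Matrix (S × S) (S × S) ℂ) : Matrix (Option S × S) (Option S × S) ℂ :=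
  Matrix.of fun p q => p.1.elim 0 fun x => q.1.elim 0 fun y => Z (x, p.2) (y, q.2)

/-- The operator `|none⟩⟨none| ⊗ X`, supported on the additional level of the ancilla. -/
def flag (X : Matrix S S ℂ) : Matrix (Option S × S) (Option S × S) ℂ :=
  Matrix.of fun p q => p.1.elim (q.1.elim (X p.2 q.2) fun _ => 0) fun _ => 0

theorem idTensor_embed (Φ : OpMap S) (Z : Matrix (S × S) (S × S) ℂ) :
    idTensor (Option S) Φ (embed Z) = embed (idTensor S Φ Z) := by
  ext ⟨p, i⟩ ⟨q, j⟩
  rcases p with _ | x <;> rcases q with _ | y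
  · exact congrFun (congrFun (map_zero Φ) i) j
  · exact congrFun (congrFun (map_zero Φ) i) j
  · exact congrFun (congrFun (map_zero Φ) i) j
  · rfl

theorem idTensor_flag (Φ : OpMap S) (X : Matrix S S ℂ) :
    idTensor (Option S) Φ (flag X) = flag (Φ X) := by
  ext ⟨p, i⟩ ⟨q, j⟩
  rcases p with _ | x <;> rcases q with _ | y
  · rfl
  · exact congrFun (congrFun (map_zero Φ) i) j
  · exact congrFun (congrFun (map_zero Φ) i) j
  · exact congrFun (congrFun (map_zero Φ) i) j

theorem embed_sub (Z W : Matrix (S × S) (S × S) ℂ) : embed (Z - W) = embed Z - embed W := by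
  ext ⟨p, i⟩ ⟨q, j⟩
  rcases p with _ | x <;> rcases q with _ | y <;> simp [embed]

theorem embed_isHermitian {Z : Matrix (S × S) (S × S) ℂ} (hZ : Z.IsHermitian) :
    (embed Z).IsHermitian := by
  ext ⟨p, i⟩ ⟨q, j⟩
  rcases p with _ | x <;> rcases q with _ | y <;> simp [embed]
  exact hZ.apply (x, i) (y, j)

theorem embed_one_add_flag_one [DecidableEq S] : embed 1 + flag 1 =
    (1 : Matrix (Option S × S) (Option S × S) ℂ) := by
  ext ⟨p, i⟩ ⟨q, j⟩
  rcases p with _ | x <;> rcases q with _ | y <;> simp [embed, flag, Matrix.one_apply]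

variable [Fintype S]

theorem embed_mul (Z W : Matrix (S × S) (S × S) ℂ) : embed Z * embed W = embed (Z * W) := by
  ext ⟨p, i⟩ ⟨q, j⟩
  rcases p with _ | x <;> rcases q with _ | y <;>
    simp [embed, Matrix.mul_apply, Fintype.sum_prod_type]

theorem flag_mul_embed (X : Matrix S S ℂ) (W : Matrix (S × S) (S × S) ℂ) :
    flag X * embed W = 0 := by
  ext ⟨p, i⟩ ⟨q, j⟩
  rcases p with _ | x <;> rcases q with _ | y <;>
    simp [embed, flag, Matrix.mul_apply, Fintype.sum_prod_type]

theorem trace_embed (Z : Matrix (S × S) (S × S) ℂ) : (embed Z).trace = Z.trace := by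
  simp [embed, Matrix.trace, Fintype.sum_prod_type]

theorem trace_flag (X : Matrix S S ℂ) : (flag X).trace = X.trace := by
  simp [flag, Matrix.trace, Fintype.sum_prod_type]

theorem embed_posSemidef {Z : Matrix (S × S) (S × S) ℂ} (hZ : Z.PosSemidef) :
    (embed Z).PosSemidef := by
  refine .of_dotProduct_mulVec_nonneg (embed_isHermitian hZ.1) fun v => ?_
  convert hZ.dotProduct_mulVec_nonneg fun p => v (some p.1, p.2) using 1
  simp [embed, dotProduct, mulVec, Fintype.sum_prod_type]

theorem flag_posSemidef {X : Matrix S S ℂ} (hX : X.PosSemidef) : (flag X).PosSemidef := by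
  refine .of_dotProduct_mulVec_nonneg ?_ fun v => ?_
  · ext ⟨p, i⟩ ⟨q, j⟩
    rcases p with _ | x <;> rcases q with _ | y <;> simp [flag]
    exact hX.1.apply i j
  · convert hX.dotProduct_mulVec_nonneg fun i => v (none, i) using 1
    simp [flag, dotProduct, mulVec, Fintype.sum_prod_type]

variable [DecidableEq S] [Nonempty S]

/-- Every Hermitian `Z` of nonnegative trace gives two states whose difference is, up to a
positive factor, `Z` minus a positive operator of the same trace on the additional level. -/
theorem exists_states_sub_eq {Z : Matrix (S × S) (S × S) ℂ} (hZ : Z.IsHermitian)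
    (ht : 0 ≤ Z.trace) :
    ∃ ρ' ρ'' : Matrix (Option S × S) (Option S × S) ℂ, IsState ρ' ∧ IsState ρ'' ∧
      ∃ r : ℝ, 0 < r ∧ ρ' - ρ'' =
        (r : ℂ) • (embed Z - flag ((Z.trace / Fintype.card S) • (1 : Matrix S S ℂ))) := by
  obtain ⟨c, hc, hpsd⟩ := exists_smul_one_add_posSemidef (embed_isHermitian hZ)
  set N : ℝ := (Fintype.card (Option S × S) : ℝ) with hN
  have hNpos : 0 < N := by rw [hN]; exact_mod_cast Fintype.card_pos
  have hd : (0 : ℝ) < Fintype.card S := by exact_mod_cast Fintype.card_pos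
  obtain ⟨t, ht0, htZ⟩ : ∃ t : ℝ, 0 ≤ t ∧ Z.trace = t :=
    ⟨Z.trace.re, (Complex.le_def.1 ht).1, (Complex.ext rfl (Complex.le_def.1 ht).2.symm)⟩
  have hs : 0 < c * N + t := by positivity
  have hs' : (0 : ℂ) ≤ (((c * N + t)⁻¹ : ℝ) : ℂ) := Complex.zero_le_real.2 (by positivity)
  have htr : ((c : ℂ) • (1 : Matrix (Option S × S) (Option S × S) ℂ)).trace = c * N := by
    rw [Matrix.trace_smul, Matrix.trace_one, smul_eq_mul, hN]
    norm_cast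
  have hflag : (flag ((Z.trace / Fintype.card S) • (1 : Matrix S S ℂ))).trace = t := by
    rw [trace_flag, Matrix.trace_smul, Matrix.trace_one, smul_eq_mul, htZ]
    have : (Fintype.card S : ℂ) ≠ 0 := by exact_mod_cast hd.ne'
    field_simp
  have hnorm : (((c * N + t)⁻¹ : ℝ) : ℂ) * (c * N + t) = 1 := by
    rw [← Complex.ofReal_mul, ← Complex.ofReal_add, ← Complex.ofReal_mul, inv_mul_cancel₀ hs.ne',
      Complex.ofReal_one]
  have hflagpsd : (flag ((Z.trace / Fintype.card S) • (1 : Matrix S S ℂ))).PosSemidef := by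
    refine flag_posSemidef (PosSemidef.one.smul ?_)
    rw [htZ]
    exact_mod_cast div_nonneg ht0 hd.le
  refine ⟨(((c * N + t)⁻¹ : ℝ) : ℂ) • ((c : ℂ) • (1 : Matrix _ _ ℂ) + embed Z),
    (((c * N + t)⁻¹ : ℝ) : ℂ) • ((c : ℂ) • (1 : Matrix _ _ ℂ) +
      flag ((Z.trace / Fintype.card S) • (1 : Matrix S S ℂ))), ⟨hpsd.smul hs', ?_⟩,
    ⟨((PosSemidef.one.smul (Complex.zero_le_real.2 hc.le)).add hflagpsd).smul hs', ?_⟩,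
    (c * N + t)⁻¹, by positivity, ?_⟩
  · rw [Matrix.trace_smul, Matrix.trace_add, htr, trace_embed, htZ, smul_eq_mul, hnorm]
  · rw [Matrix.trace_smul, Matrix.trace_add, htr, hflag, smul_eq_mul, hnorm]
  · module

/-- The effect `R` suppresses a direction `v` in which the quadratic form of `Y` is negative. -/
theorem exists_effect_of_not_posSemidef {n : Type*} [Fintype n] [DecidableEq n]
    {Y : Matrix n n ℂ} (hY : Y.IsHermitian) (h : ¬ Y.PosSemidef) :
    ∃ R : Matrix n n ℂ, R.PosSemidef ∧ (1 - R).PosSemidef ∧ Y.trace.re < (Y * R).trace.re := by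
  obtain ⟨v, hv⟩ : ∃ v : n → ℂ, (star v ⬝ᵥ (Y *ᵥ v)).re < 0 := by
    by_contra! hcon
    exact h (.of_dotProduct_mulVec_nonneg hY fun v =>
      Complex.le_def.2 ⟨hcon v, (hY.im_star_dotProduct_mulVec_self v).symm⟩)
  have hvv : (vecMulVec v (star v)).PosSemidef := posSemidef_vecMulVec_self_star v
  obtain ⟨c, hc, hpsd⟩ := exists_smul_one_add_posSemidef hvv.1.neg
  have hc' : (0 : ℂ) ≤ ((c⁻¹ : ℝ) : ℂ) := Complex.zero_le_real.2 (by positivity)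
  have hcc : ((c⁻¹ : ℝ) : ℂ) * (c : ℂ) = 1 := by
    rw [← Complex.ofReal_mul, inv_mul_cancel₀ hc.ne', Complex.ofReal_one]
  refine ⟨1 - ((c⁻¹ : ℝ) : ℂ) • vecMulVec v (star v), ?_, ?_, ?_⟩
  · convert hpsd.smul hc' using 1
    rw [smul_add, smul_smul, hcc, one_smul, smul_neg, sub_eq_add_neg]
  · rw [sub_sub_cancel]
    exact hvv.smul hc'
  · rw [Matrix.mul_sub, Matrix.mul_one, Matrix.trace_sub, Complex.sub_re, Matrix.mul_smul,
      Matrix.trace_smul, Matrix.mul_vecMulVec, Matrix.trace_vecMulVec, smul_eq_mul,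
      Complex.re_ofReal_mul, dotProduct_comm]
    have : c⁻¹ * (star v ⬝ᵥ (Y *ᵥ v)).re < 0 := mul_neg_of_pos_of_neg (by positivity) hv
    linarith

omit [Nonempty S] in
/-- If `id ⊗ Φ` maps `Z` to a positive operator and `id ⊗ Ψ` does not, then the two states of
`exists_states_sub_eq` are better distinguishable after `Ψ` than after `Φ`. -/
theorem traceNorm_lt_of_not_posSemidef {Φ Ψ : OpMap S} (hΦ : IsCP Φ) (hΦ' : IsTP Φ)
    (hΨ : IsCP Ψ) (hΨ' : IsTP Ψ) {Z : Matrix (S × S) (S × S) ℂ} (hZ : Z.IsHermitian)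
    (hpos : (idTensor S Φ Z).PosSemidef) (hneg : ¬ (idTensor S Ψ Z).PosSemidef)
    {ρ' ρ'' : Matrix (Option S × S) (Option S × S) ℂ} (h' : IsState ρ') (h'' : IsState ρ'')
    {r : ℝ} (hr : 0 < r) (hsub : ρ' - ρ'' =
      (r : ℂ) • (embed Z - flag ((Z.trace / Fintype.card S) • (1 : Matrix S S ℂ)))) :
    traceNorm (idTensor (Option S) Φ ρ' - idTensor (Option S) Φ ρ'') <
      traceNorm (idTensor (Option S) Ψ ρ' - idTensor (Option S) Ψ ρ'') := by
  have ht : 0 ≤ Z.trace := by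
    rw [← trace_idTensor hΦ' Z]; exact hpos.trace_nonneg
  set F : Matrix S S ℂ := (Z.trace / Fintype.card S) • (1 : Matrix S S ℂ) with hF
  have hFpos : F.PosSemidef := by
    refine PosSemidef.one.smul ?_
    rw [Complex.le_def] at ht ⊢
    simp only [Complex.div_natCast_re, Complex.div_natCast_im, Complex.zero_re,
      Complex.zero_im] at ht ⊢
    exact ⟨div_nonneg ht.1 (Nat.cast_nonneg _), by rw [← ht.2, zero_div]⟩
  have hdiff : ∀ Θ : OpMap S, idTensor (Option S) Θ ρ' - idTensor (Option S) Θ ρ'' =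
      (r : ℂ) • (embed (idTensor S Θ Z) - flag (Θ F)) := fun Θ => by
    rw [← idTensor_sub Θ, hsub, idTensor_smul, idTensor_sub, idTensor_embed, idTensor_flag]
  have hscore : ∀ (Θ : OpMap S) (Q : Matrix (Option S × S) (Option S × S) ℂ),
      ((idTensor (Option S) Θ ρ' - idTensor (Option S) Θ ρ'') * Q).trace.re =
        r * ((embed (idTensor S Θ Z) * Q).trace.re - (flag (Θ F) * Q).trace.re) := fun Θ Q => by
    rw [hdiff, Matrix.smul_mul, Matrix.trace_smul, smul_eq_mul, Complex.re_ofReal_mul,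
      Matrix.sub_mul, Matrix.trace_sub, Complex.sub_re]
  have hherm : ∀ Θ : OpMap S, IsCP Θ →
      (idTensor (Option S) Θ ρ' - idTensor (Option S) Θ ρ'').IsHermitian := fun Θ hΘ =>
    (idTensor_posSemidef hΘ h'.1).1.sub (idTensor_posSemidef hΘ h''.1).1
  have htrace : ∀ Θ : OpMap S, IsTP Θ →
      (idTensor (Option S) Θ ρ' - idTensor (Option S) Θ ρ'').trace = 0 := fun Θ hΘ => by
    rw [Matrix.trace_sub, trace_idTensor hΘ, trace_idTensor hΘ, h'.2, h''.2, sub_self]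
  -- under `Φ`, every effect scores at most the trace of the positive operator `(id ⊗ Φ)(Z)`
  obtain ⟨Q, hQ, hQ', hQe⟩ := exists_effect_traceNorm (hherm Φ hΦ) (htrace Φ hΦ')
  have hup : traceNorm (idTensor (Option S) Φ ρ' - idTensor (Option S) Φ ρ'') / 2 ≤
      r * Z.trace.re := by
    rw [← hQe, hscore]
    refine mul_le_mul_of_nonneg_left ?_ hr.le
    have h1 := re_trace_mul_le_re_trace (embed_posSemidef hpos) hQ'
    have h2 := re_trace_mul_nonneg (flag_posSemidef (map_posSemidef hΦ hFpos)) hQ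
    rw [trace_embed, trace_idTensor hΦ'] at h1
    linarith
  -- under `Ψ`, an effect on the first `dim S` levels of the ancilla scores more
  obtain ⟨R, hR, hR', hlt⟩ := exists_effect_of_not_posSemidef (idTensor_isHermitian hΨ hZ) hneg
  have hRc : (1 - embed R).PosSemidef := by
    rw [← embed_one_add_flag_one, add_sub_right_comm, ← embed_sub]
    exact (embed_posSemidef hR').add (flag_posSemidef .one)
  have hlow := re_trace_mul_le_traceNorm (hherm Ψ hΨ) (htrace Ψ hΨ') (embed_posSemidef hR) hRc
  rw [hscore, embed_mul, trace_embed, flag_mul_embed, Matrix.trace_zero, Complex.zero_re,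
    sub_zero] at hlow
  rw [trace_idTensor hΨ'] at hlt
  have := mul_lt_mul_of_pos_left hlt hr
  linarith

end Witness

/-! ### Extension of positive functionals from the range of a positive map -/

section Extension

variable {n : Type*} [Fintype n] [DecidableEq n]

theorem im_eq_zero_of_nonneg {z : ℂ} (h : 0 ≤ z) : z.im = 0 := (Complex.le_def.1 h).2.symm

/-- A pseudoinverse `P` of a positive `M`; the second statement says that `M² ≤ C M³`, since the
nonzero eigenvalues of `M` are bounded from below. -/
theorem exists_pseudoinverse {M : Matrix n n ℂ} (hM : M.PosSemidef) :
    ∃ P : Matrix n n ℂ, M * (M * P) = M ∧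
      ∃ C : ℝ, 0 ≤ C ∧ ((C : ℂ) • (M * M * M) - M * M).PosSemidef := by
  obtain ⟨U, hU, hU', h⟩ := exists_unitary_diagonal hM.1
  set l := hM.1.eigenvalues with hl
  have hl0 : ∀ i, 0 ≤ l i := hM.eigenvalues_nonneg
  have hmul : ∀ D E : Matrix n n ℂ, (U * D * Uᴴ) * (U * E * Uᴴ) = U * (D * E) * Uᴴ := by
    intro D E
    calc (U * D * Uᴴ) * (U * E * Uᴴ) = U * (D * (Uᴴ * U) * E) * Uᴴ := by
          simp only [Matrix.mul_assoc]
      _ = _ := by rw [hU, Matrix.mul_one]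
  refine ⟨U * diagonal (fun i => ((l i)⁻¹ : ℂ)) * Uᴴ, ?_, ∑ i, (l i)⁻¹,
    Finset.sum_nonneg fun i _ => inv_nonneg.2 (hl0 i), ?_⟩
  · rw [h, hmul, hmul, diagonal_mul_diagonal, diagonal_mul_diagonal]
    congr 3
    funext i
    by_cases hi : l i = 0
    · simp [hi]
    · have : (l i : ℂ) ≠ 0 := by exact_mod_cast hi
      field_simp
  · have : ((∑ i, (l i)⁻¹ : ℝ) : ℂ) • (M * M * M) - M * M =
        U * diagonal (fun i => (((∑ i, (l i)⁻¹) * (l i * l i * l i) - l i * l i : ℝ) : ℂ)) *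
          Uᴴ := by
      have hd : diagonal (fun i => (((∑ i, (l i)⁻¹) * (l i * l i * l i) - l i * l i : ℝ) : ℂ)) =
          ((∑ i, (l i)⁻¹ : ℝ) : ℂ) • diagonal (fun i => (l i : ℂ) * l i * l i) -
            diagonal (fun i => (l i : ℂ) * l i) := by
        rw [← diagonal_smul, diagonal_sub]
        congr 1
        funext i
        push_cast
        simp
      rw [hd, Matrix.mul_sub, Matrix.sub_mul, Matrix.mul_smul, Matrix.smul_mul,
        ← diagonal_mul_diagonal, ← diagonal_mul_diagonal, ← hmul, ← hmul, ← h]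
    rw [this]
    refine PosSemidef.mul_mul_conjTranspose_same (posSemidef_diagonal_iff.2 fun i => ?_) U
    rw [Complex.zero_le_real]
    have h1 : (l i)⁻¹ ≤ ∑ i, (l i)⁻¹ :=
      Finset.single_le_sum (f := fun i => (l i)⁻¹) (fun j _ => inv_nonneg.2 (hl0 j))
        (Finset.mem_univ i)
    rcases (hl0 i).eq_or_lt with h0 | h0
    · simp [← h0]
    · have h2 : 1 ≤ (∑ i, (l i)⁻¹) * l i := by
        have := mul_le_mul_of_nonneg_right h1 h0.le
        rwa [inv_mul_cancel₀ h0.ne'] at this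
      nlinarith [mul_pos h0 h0]

/-- An operator in the range of a positive map `T` is supported on the support of `T 1`, so its
positivity can be tested after multiplication by `T 1` from both sides. -/
theorem posSemidef_of_mul_mul_posSemidef {T : Matrix n n ℂ →ₗ[ℂ] Matrix n n ℂ}
    (hT : ∀ X : Matrix n n ℂ, X.PosSemidef → (T X).PosSemidef) {A : Matrix n n ℂ}
    (hA : A.IsHermitian) (h : (T 1 * T A * T 1).PosSemidef) : (T A).PosSemidef := by
  have hM : (T 1).PosSemidef := hT _ .one
  have hTA := positive_map_isHermitian hT hA
  obtain ⟨P, hP, -⟩ := exists_pseudoinverse hM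
  have hker : ∀ w : n → ℂ, T 1 *ᵥ w = 0 → T A *ᵥ w = 0 := by
    intro w hw
    obtain ⟨c, -, hc⟩ := exists_smul_one_add_posSemidef hA
    obtain ⟨c', -, hc'⟩ := exists_smul_one_add_posSemidef hA.neg
    have h1 := hT _ hc
    have h2 := (hT _ hc').dotProduct_mulVec_nonneg w
    have h3 := h1.dotProduct_mulVec_nonneg w
    rw [map_add, map_smul, Matrix.add_mulVec, Matrix.smul_mulVec, hw, smul_zero, zero_add] at h3
    rw [map_add, map_smul, map_neg, Matrix.add_mulVec, Matrix.smul_mulVec, hw, smul_zero, zero_add,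
      Matrix.neg_mulVec, dotProduct_neg, neg_nonneg] at h2
    have h4 := (h1.dotProduct_mulVec_zero_iff w).1 (by
      rw [map_add, map_smul, Matrix.add_mulVec, Matrix.smul_mulVec, hw, smul_zero, zero_add]
      exact le_antisymm h2 h3)
    rwa [map_add, map_smul, Matrix.add_mulVec, Matrix.smul_mulVec, hw, smul_zero, zero_add] at h4
  have hE : T A * (T 1 * P) = T A := by
    refine Matrix.ext_of_mulVec_single fun i => ?_
    have h0 := hker (Pi.single i 1 - (T 1 * P) *ᵥ Pi.single i 1) (by
      rw [Matrix.mulVec_sub, Matrix.mulVec_mulVec, hP, sub_self])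
    rw [Matrix.mulVec_sub, Matrix.mulVec_mulVec, sub_eq_zero] at h0
    exact h0.symm
  have hE' : (T 1 * P)ᴴ * T A = T A := by
    have := congrArg conjTranspose hE
    rwa [conjTranspose_mul, hTA.eq] at this
  have := h.conjTranspose_mul_mul_same P
  convert this using 1
  calc T A = (T 1 * P)ᴴ * (T A * (T 1 * P)) := by rw [hE, hE']
    _ = _ := by rw [conjTranspose_mul, hM.1.eq]; simp only [Matrix.mul_assoc]

/-- A functional that is positive on the range of a positive map agrees on that range with a
functional that is positive everywhere. This is M. Riesz' extension theorem for the cone of all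
`Y` with `T 1 * Y * T 1` positive: for operators in the range it is the positive cone, and
`T 1` is an order unit for it. -/
theorem exists_positive_extension {T : Matrix n n ℂ →ₗ[ℂ] Matrix n n ℂ}
    (hT : ∀ X : Matrix n n ℂ, X.PosSemidef → (T X).PosSemidef)
    (L : Matrix n n ℂ →ₗ[ℂ] ℂ)
    (hL : ∀ A : Matrix n n ℂ, A.IsHermitian → (T A).PosSemidef → 0 ≤ L (T A)) :
    ∃ G : Matrix n n ℂ →ₗ[ℂ] ℂ, (∀ Z, G (T Z) = L (T Z)) ∧
      ∀ X : Matrix n n ℂ, X.PosSemidef → 0 ≤ G X := by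
  set M := T 1 with hMdef
  have hM : M.PosSemidef := hT _ .one
  have hreal : ∀ A : Matrix n n ℂ, A.IsHermitian → (L (T A)).im = 0 := fun A hA => by
    obtain ⟨c, hc, h⟩ := exists_smul_one_add_posSemidef hA
    have h1 := hL _ h.1 (hT _ h)
    have h2 := hL _ PosSemidef.one.1 hM
    rw [map_add, map_add, map_smul, map_smul] at h1
    have h3 := im_eq_zero_of_nonneg h1
    rwa [Complex.add_im, smul_eq_mul, Complex.im_ofReal_mul, im_eq_zero_of_nonneg h2, mul_zero,
      zero_add] at h3
  -- the anti-Hermitian part of `Y` does not matter for membership in the cone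
  have hform : ∀ (A B : Matrix n n ℂ), A.IsHermitian → B.IsHermitian → ∀ v : n → ℂ,
      (star v ⬝ᵥ ((M * (A + Complex.I • B) * M) *ᵥ v)).re =
        (star v ⬝ᵥ ((M * A * M) *ᵥ v)).re := by
    intro A B hA hB v
    have h1 : (M * B * M).IsHermitian := by
      have := isHermitian_conjTranspose_mul_mul M hB
      rwa [hM.1.eq] at this
    have h2 := h1.im_star_dotProduct_mulVec_self v
    rw [Matrix.mul_add, Matrix.add_mul, Matrix.add_mulVec, dotProduct_add, Complex.add_re,
      Matrix.mul_smul, Matrix.smul_mul, Matrix.smul_mulVec, dotProduct_smul, smul_eq_mul,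
      Complex.I_mul_re]
    have h3 : (star v ⬝ᵥ ((M * B * M) *ᵥ v)).im = 0 := h2
    rw [h3]; simp
  have hpsd : ∀ A : Matrix n n ℂ, A.IsHermitian →
      (∀ v : n → ℂ, 0 ≤ (star v ⬝ᵥ ((M * A * M) *ᵥ v)).re) → (M * A * M).PosSemidef := by
    intro A hA h
    have h1 : (M * A * M).IsHermitian := by
      have := isHermitian_conjTranspose_mul_mul M hA
      rwa [hM.1.eq] at this
    exact .of_dotProduct_mulVec_nonneg h1 fun v =>
      Complex.le_def.2 ⟨h v, (h1.im_star_dotProduct_mulVec_self v).symm⟩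
  let s : PointedCone ℝ (Matrix n n ℂ) :=
    { carrier := {Y | ∀ v : n → ℂ, 0 ≤ (star v ⬝ᵥ ((M * Y * M) *ᵥ v)).re}
      add_mem' := fun {X Y} hX hY v => by
        rw [Matrix.mul_add, Matrix.add_mul, Matrix.add_mulVec, dotProduct_add, Complex.add_re]
        exact add_nonneg (hX v) (hY v)
      zero_mem' := fun v => by simp
      smul_mem' := fun c Y hY v => by
        have : M * (c • Y) * M = (c : ℝ) • (M * Y * M) := by
          rw [← Matrix.smul_mul, ← Matrix.mul_smul]; rfl
        rw [this, Matrix.smul_mulVec, dotProduct_smul, Complex.smul_re]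
        exact mul_nonneg c.2 (hY v) }
  have hmem : ∀ Y, Y ∈ s ↔ ∀ v : n → ℂ, 0 ≤ (star v ⬝ᵥ ((M * Y * M) *ᵥ v)).re := fun Y => Iff.rfl
  let f : Matrix n n ℂ →ₗ.[ℝ] ℝ :=
    { domain := (LinearMap.range T).restrictScalars ℝ
      toFun := (Complex.reLm ∘ₗ L.restrictScalars ℝ).domRestrict _ }
  have hf : ∀ x : f.domain, f x = (L x).re := fun x => rfl
  obtain ⟨g, hg, hgs⟩ := riesz_extension s f (by
    rintro ⟨_, Z, rfl⟩ hx
    obtain ⟨A, B, hA, hB, rfl, -⟩ := exists_hermitian_decomp Z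
    rw [hf]
    simp only [map_add, map_smul] at hx ⊢
    have h1 := posSemidef_of_mul_mul_posSemidef hT hA (hpsd _ (positive_map_isHermitian hT hA)
      fun v => by
        rw [← hform _ (T B) (positive_map_isHermitian hT hA) (positive_map_isHermitian hT hB)]
        exact hx v)
    rw [Complex.add_re, smul_eq_mul, Complex.I_mul_re, hreal B hB, neg_zero, add_zero]
    exact (Complex.le_def.1 (hL A hA h1)).1) (by
    intro y
    obtain ⟨A, B, hA, hB, rfl, -⟩ := exists_hermitian_decomp y
    obtain ⟨κ, hκ, hκA⟩ := exists_smul_one_add_posSemidef hA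
    obtain ⟨-, -, C, hC, hCM⟩ := exists_pseudoinverse hM
    refine ⟨⟨((κ * C : ℝ) : ℂ) • M, ((κ * C : ℝ) : ℂ) • 1, by rw [map_smul]⟩, ?_⟩
    rw [hmem]
    intro v
    have h1 : (((κ * C : ℝ) : ℂ) • M + A).IsHermitian := by
      refine IsHermitian.add ?_ hA
      exact (hM.smul (Complex.zero_le_real.2 (by positivity))).1
    rw [← add_assoc, hform _ _ h1 hB]
    have h2 : M * (((κ * C : ℝ) : ℂ) • M + A) * M =
        (κ : ℂ) • ((C : ℂ) • (M * M * M) - M * M) + M * ((κ : ℂ) • 1 + A) * M := by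
      simp only [Matrix.mul_add, Matrix.add_mul, Matrix.mul_smul, Matrix.smul_mul, Matrix.mul_one,
        smul_sub, smul_smul, Complex.ofReal_mul]
      abel
    rw [h2]
    have h3 := hκA.conjTranspose_mul_mul_same M
    rw [hM.1.eq] at h3
    exact (Complex.le_def.1 (((hCM.smul (Complex.zero_le_real.2 hκ.le)).add
      h3).dotProduct_mulVec_nonneg v)).1)
  refine ⟨Module.Dual.extendRCLike (𝕜 := ℂ) g, fun Z => ?_, fun X hX => ?_⟩
  · have h1 : g (T Z) = (L (T Z)).re := hg ⟨T Z, Z, rfl⟩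
    have h2 : g (Complex.I • T Z) = (L (Complex.I • T Z)).re :=
      hg ⟨Complex.I • T Z, Complex.I • Z, by rw [map_smul]⟩
    refine Complex.ext ?_ ?_
    · exact (Module.Dual.re_extendRCLike_apply (𝕜 := ℂ) g _).trans h1
    · refine (Module.Dual.im_extendRCLike_apply (𝕜 := ℂ) g _).trans ?_
      change -g (Complex.I • T Z) = _
      rw [h2, map_smul, smul_eq_mul, Complex.I_mul_re, neg_neg]
  · have hI : ∀ c : ℝ, 0 ≤ g ((c : ℂ) • Complex.I • X) := fun c => hgs _ <| by
      rw [hmem]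
      intro v
      have h1 := hform 0 ((c : ℂ) • X) isHermitian_zero (by
        unfold IsHermitian; rw [conjTranspose_smul, hX.1.eq]; simp) v
      rw [zero_add, smul_comm] at h1
      rw [h1]; simp
    have hI0 : g (Complex.I • X) = 0 := by
      have h1 := hI 1
      have h2 := hI (-1)
      simp only [Complex.ofReal_neg, Complex.ofReal_one, neg_smul, one_smul, map_neg] at h1 h2
      linarith
    have hre : 0 ≤ g X := hgs _ <| by
      rw [hmem]
      intro v
      have := hX.conjTranspose_mul_mul_same M
      rw [hM.1.eq] at this
      exact (Complex.le_def.1 (this.dotProduct_mulVec_nonneg v)).1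
    refine Complex.le_def.2 ⟨?_, ?_⟩
    · exact hre.trans_eq (Module.Dual.re_extendRCLike_apply (𝕜 := ℂ) g X).symm
    · refine Eq.symm ((Module.Dual.im_extendRCLike_apply (𝕜 := ℂ) g X).trans ?_)
      change -g (Complex.I • X) = 0
      rw [hI0, neg_zero]

end Extension

/-! ### Factorisation through a completely positive map -/

section Factorisation

variable {S : Type*} [Fintype S] [DecidableEq S]

omit [DecidableEq S] in
theorem exists_linear_factor {Φ Ψ : OpMap S} (h : LinearMap.ker Φ ≤ LinearMap.ker Ψ) :
    ∃ V : OpMap S, Ψ = V ∘ₗ Φ := by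
  obtain ⟨s, hs⟩ := Φ.rangeRestrict.exists_rightInverse_of_surjective Φ.range_rangeRestrict
  obtain ⟨V, hV⟩ := LinearMap.exists_extend (Ψ ∘ₗ s)
  refine ⟨V, LinearMap.ext fun X => ?_⟩
  have h1 : V (Φ X) = Ψ (s (Φ.rangeRestrict X)) := LinearMap.congr_fun hV (Φ.rangeRestrict X)
  have h2 : Φ (s (Φ.rangeRestrict X)) = Φ X :=
    congrArg Subtype.val (LinearMap.congr_fun hs (Φ.rangeRestrict X))
  rw [LinearMap.comp_apply, h1, ← sub_eq_zero, ← map_sub]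
  exact h (by rw [LinearMap.mem_ker, map_sub, h2, sub_self])

omit [DecidableEq S] in
theorem eq_zero_of_posSemidef_neg {A : Matrix S S ℂ} (h : A.PosSemidef) (h' : (-A).PosSemidef) :
    A = 0 := by
  rw [← h.trace_eq_zero_iff]
  have := h'.trace_nonneg
  rw [Matrix.trace_neg, neg_nonneg] at this
  exact le_antisymm this h.trace_nonneg

/-- If `id ⊗ Ψ` is positive wherever `id ⊗ Φ` is, with an ancilla of the dimension of the
system, then `Ψ` arises from `Φ` by a completely positive map. -/
theorem exists_cp_factor {Φ Ψ : OpMap S} (hΦ : IsCP Φ)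
    (h : ∀ Z : Matrix (S × S) (S × S) ℂ, Z.IsHermitian → (idTensor S Φ Z).PosSemidef →
      (idTensor S Ψ Z).PosSemidef) :
    ∃ W : OpMap S, IsCP W ∧ Ψ = W ∘ₗ Φ := by
  have hblock : ∀ (Θ : OpMap S) (X : Matrix S S ℂ) (p q : S),
      idTensor S Θ (Matrix.single p q (1 : ℂ) ⊗ₖ X) = Matrix.single p q (1 : ℂ) ⊗ₖ Θ X := by
    intro Θ X p q
    ext x y
    have hb : block (Matrix.single p q (1 : ℂ) ⊗ₖ X) x.1 y.1 =
        Matrix.single p q (1 : ℂ) x.1 y.1 • X := rfl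
    rw [idTensor_apply, hb, map_smul]
    rfl
  -- the kernel of `Φ` is spanned by Hermitian operators, on which both signs can be tested
  have hkerH : ∀ A : Matrix S S ℂ, A.IsHermitian → Φ A = 0 → Ψ A = 0 := by
    intro A hA h0
    have key : ∀ B : Matrix S S ℂ, B.IsHermitian → Φ B = 0 → (Ψ B).PosSemidef := by
      intro B hB h0
      have hempty : IsEmpty S ∨ Nonempty S := isEmpty_or_nonempty S
      rcases hempty with hS | ⟨⟨x⟩⟩
      · rw [Subsingleton.elim (Ψ B) 0]; exact .zero
      have h1 := h (Matrix.single x x (1 : ℂ) ⊗ₖ B) (by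
        unfold IsHermitian
        rw [conjTranspose_kronecker, hB.eq, conjTranspose_single, star_one])
        (by rw [hblock, h0, kronecker_zero]; exact .zero)
      rw [hblock] at h1
      convert h1.submatrix fun i => (x, i) using 1
      ext i j
      simp
    exact eq_zero_of_posSemidef_neg (key A hA h0)
      (by rw [← map_neg]; exact key (-A) hA.neg (by rw [map_neg, h0, neg_zero]))
  obtain ⟨V, hV⟩ := exists_linear_factor (Φ := Φ) (Ψ := Ψ) fun X hX => by
    rw [LinearMap.mem_ker] at hX ⊢
    have hX' : Φ Xᴴ = 0 := by rw [map_conjTranspose hΦ, hX, conjTranspose_zero]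
    obtain ⟨A, B, hA, hB, h1, h2⟩ := exists_hermitian_decomp X
    have e1 : Φ A + Complex.I • Φ B = 0 := by rw [← map_smul, ← map_add, ← h1, hX]
    have e2 : Φ A - Complex.I • Φ B = 0 := by rw [← map_smul, ← map_sub, ← h2, hX']
    have hA0 : Φ A = 0 := by
      have : (2 : ℂ) • Φ A = (Φ A + Complex.I • Φ B) + (Φ A - Complex.I • Φ B) := by module
      rw [e1, e2, add_zero] at this
      exact (smul_eq_zero.1 this).resolve_left two_ne_zero
    have hB0 : Φ B = 0 := by
      rw [hA0, zero_add, smul_eq_zero] at e1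
      exact e1.resolve_left Complex.I_ne_zero
    rw [h1, map_add, map_smul, hkerH A hA hA0, hkerH B hB hB0]
    simp
  let L : Matrix (S × S) (S × S) ℂ →ₗ[ℂ] ℂ :=
    ∑ x, ∑ y, Matrix.entryLinearMap ℂ ℂ (x, x) (y, y) ∘ₗ idTensorₗ S V
  have hLe : ∀ X, L X = entangledForm V X := fun X => by
    simp [L, entangledForm]
  obtain ⟨G, hG, hGpos⟩ := exists_positive_extension (T := idTensorₗ S Φ)
    (fun X hX => idTensor_posSemidef hΦ hX) L (fun A hA hpos => by
      have h1 := (h A hA hpos).dotProduct_mulVec_nonneg fun p => if p.1 = p.2 then 1 else 0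
      convert h1 using 1
      rw [hLe, hV]
      simp [entangledForm, dotProduct, mulVec, Fintype.sum_prod_type, apply_ite, idTensor_comp])
  let W : OpMap S :=
    { toFun := fun X => Matrix.of fun p q => G (Matrix.single p q (1 : ℂ) ⊗ₖ X)
      map_add' := fun X Y => by
        ext p q
        simp [kronecker_add]
      map_smul' := fun c X => by
        ext p q
        simp [kronecker_smul] }
  have hW : ∀ X p q, W X p q = G (Matrix.single p q (1 : ℂ) ⊗ₖ X) := fun _ _ _ => rfl
  refine ⟨W, isCP_of_entangledForm_nonneg fun X hX => ?_, LinearMap.ext fun X => ?_⟩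
  · convert hGpos X hX using 1
    have hX' : X = ∑ x, ∑ y, Matrix.single x y (1 : ℂ) ⊗ₖ block X x y := by
      ext p q
      simp [Matrix.sum_apply, Matrix.single_apply, ite_and, block]
    conv_rhs => rw [hX']
    simp only [map_sum, entangledForm, idTensor_apply, hW]
  · ext p q
    rw [LinearMap.comp_apply, hW, ← hblock, ← idTensorₗ_apply, hG, hLe, hV]
    simp only [idTensorₗ_apply, hblock, entangledForm, idTensor_apply]
    have hb : ∀ x y, block (Matrix.single p q (1 : ℂ) ⊗ₖ Φ X) x y =
        Matrix.single p q (1 : ℂ) x y • Φ X := fun _ _ => rfl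
    simp only [hb, map_smul, Matrix.smul_apply]
    simp [Matrix.single_apply, ite_and]

end Factorisation

/-! ### Limits of completely positive trace preserving factors -/

section Compactness

open Filter Topology

variable {S : Type*} [Fintype S] [DecidableEq S]

theorem norm_apply_le_re_trace {n : Type*} [Fintype n] [DecidableEq n] {C : Matrix n n ℂ}
    (hC : C.PosSemidef) (i j : n) : ‖C i j‖ ≤ C.trace.re := by
  obtain ⟨B, rfl⟩ : ∃ B : Matrix n n ℂ, C = Bᴴ * B := by
    open MatrixOrder in
    exact CStarAlgebra.nonneg_iff_eq_star_mul_self.mp hC.nonneg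
  have hdiag : ∀ i, ((Bᴴ * B) i i).re = ∑ k, ‖B k i‖ ^ 2 := fun i => by
    rw [Matrix.mul_apply, Complex.re_sum]
    refine Finset.sum_congr rfl fun k _ => ?_
    rw [Matrix.conjTranspose_apply, RCLike.star_def, ← Complex.normSq_eq_conj_mul_self,
      Complex.ofReal_re, Complex.normSq_eq_norm_sq]
  have htrace : ∀ i, ∑ k, ‖B k i‖ ^ 2 ≤ (Bᴴ * B).trace.re := fun i => by
    rw [Matrix.trace, Complex.re_sum]
    simp only [Matrix.diag_apply, hdiag]
    exact Finset.single_le_sum (f := fun i => ∑ k, ‖B k i‖ ^ 2)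
      (fun j _ => Finset.sum_nonneg fun k _ => sq_nonneg _) (Finset.mem_univ i)
  have h1 : ‖(Bᴴ * B) i j‖ ≤ ∑ k, (‖B k i‖ ^ 2 + ‖B k j‖ ^ 2) / 2 := by
    rw [Matrix.mul_apply]
    refine (norm_sum_le _ _).trans (Finset.sum_le_sum fun k _ => ?_)
    rw [norm_mul, Matrix.conjTranspose_apply, norm_star]
    nlinarith [sq_nonneg (‖B k i‖ - ‖B k j‖)]
  rw [← Finset.sum_div, Finset.sum_add_distrib] at h1
  linarith [htrace i, htrace j]

theorem map_apply_eq_sum (Φ : OpMap S) (X : Matrix S S ℂ) (p q : S) :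
    Φ X p q = ∑ i, ∑ j, X i j * Φ (Matrix.single i j 1) p q := by
  conv_lhs => rw [matrix_eq_sum_single X]
  simp only [map_sum, Matrix.sum_apply]
  refine Finset.sum_congr rfl fun i _ => Finset.sum_congr rfl fun j _ => ?_
  have : Matrix.single i j (X i j) = X i j • Matrix.single i j (1 : ℂ) := by simp
  rw [this, map_smul, Matrix.smul_apply, smul_eq_mul]

/-- The entries of the Choi matrix of a completely positive trace preserving map are bounded by
its trace, which is the dimension. -/
theorem norm_map_single_le {V : OpMap S} (hV : IsCP V) (hV' : IsTP V) (i j p q : S) :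
    ‖V (Matrix.single i j 1) p q‖ ≤ (entangledState S).trace.re := by
  have h := norm_apply_le_re_trace (idTensor_posSemidef hV (entangledState_posSemidef (S := S)))
    (i, p) (j, q)
  rwa [trace_idTensor hV', idTensor_apply, block_entangledState] at h

/-- The completely positive trace preserving maps form a compact set, so a map that factors
through each member of a convergent sequence by such a map also factors through the limit. -/
theorem exists_cptp_factor_of_tendsto {Ψ Φ : OpMap S} {Φs V : ℕ → OpMap S}
    (hV : ∀ n, IsCP (V n)) (hV' : ∀ n, IsTP (V n)) (hfac : ∀ n, Ψ = V n ∘ₗ Φs n)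
    (hlim : ∀ X, Tendsto (fun n => Φs n X) atTop (𝓝 (Φ X))) :
    ∃ W : OpMap S, IsCP W ∧ IsTP W ∧ Ψ = W ∘ₗ Φ := by
  let c : ℕ → S × S → S × S → ℂ := fun n a b => V n (Matrix.single a.1 b.1 1) a.2 b.2
  have hc : ∀ n, c n ∈ Metric.closedBall (0 : S × S → S × S → ℂ) (entangledState S).trace.re := by
    intro n
    have h0 : 0 ≤ (entangledState S).trace.re :=
      (Complex.le_def.1 (entangledState_posSemidef (S := S)).trace_nonneg).1
    rw [mem_closedBall_zero_iff, pi_norm_le_iff_of_nonneg h0]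
    intro a
    rw [pi_norm_le_iff_of_nonneg h0]
    exact fun b => norm_map_single_le (hV n) (hV' n) _ _ _ _
  obtain ⟨l, -, φ, hφ, hl⟩ := tendsto_subseq_of_bounded Metric.isBounded_closedBall hc
  have hl' : ∀ i j p q, Tendsto (fun n => V (φ n) (Matrix.single i j 1) p q) atTop
      (𝓝 (l (i, p) (j, q))) := fun i j p q =>
    (tendsto_pi_nhds.1 ((tendsto_pi_nhds.1 hl) (i, p))) (j, q)
  let W : OpMap S :=
    { toFun := fun X => Matrix.of fun p q => ∑ i, ∑ j, X i j * l (i, p) (j, q)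
      map_add' := fun X Y => by
        ext p q
        simp [add_mul, Finset.sum_add_distrib]
      map_smul' := fun r X => by
        ext p q
        simp [Finset.mul_sum, mul_assoc] }
  have hW : ∀ X p q, W X p q = ∑ i, ∑ j, X i j * l (i, p) (j, q) := fun _ _ _ => rfl
  have hconv : ∀ (Y : ℕ → Matrix S S ℂ) (X : Matrix S S ℂ), Tendsto Y atTop (𝓝 X) → ∀ p q,
      Tendsto (fun n => V (φ n) (Y n) p q) atTop (𝓝 (W X p q)) := by
    intro Y X hY p q
    simp only [hW, fun n => map_apply_eq_sum (V (φ n)) (Y n) p q]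
    refine tendsto_finsetSum _ fun i _ => tendsto_finsetSum _ fun j _ => ?_
    exact ((tendsto_pi_nhds.1 ((tendsto_pi_nhds.1 hY) i)) j).mul (hl' i j p q)
  refine ⟨W, fun k X hX => posSemidef_of_forall_nonneg fun v => ?_, fun X => ?_,
    LinearMap.ext fun X => ?_⟩
  · refine ge_of_tendsto' (f := fun n => star v ⬝ᵥ (idTensor (Fin k) (V (φ n)) X *ᵥ v))
      (x := atTop) ?_ fun n => (hV (φ n) k X hX).dotProduct_mulVec_nonneg v
    simp only [dotProduct, mulVec, idTensor_apply]
    exact tendsto_finsetSum _ fun a _ => (tendsto_finsetSum _ fun b _ =>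
      (hconv _ _ tendsto_const_nhds _ _).mul_const _).const_mul _
  · have h1 : Tendsto (fun n => (V (φ n) X).trace) atTop (𝓝 (W X).trace) :=
      tendsto_finsetSum _ fun p _ => hconv _ _ tendsto_const_nhds _ _
    exact tendsto_nhds_unique h1 (by simp only [hV' _ X]; exact tendsto_const_nhds)
  · ext p q
    refine tendsto_nhds_unique ?_ (hconv _ _ ((hlim X).comp hφ.tendsto_atTop) p q)
    have : ∀ n, V (φ n) (Φs (φ n) X) = Ψ X := fun n => by rw [hfac (φ n)]; rfl
    simp only [Function.comp_apply, this]
    exact tendsto_const_nhds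

end Compactness

/-! ### Probes -/

section Probe

variable {S : Type*} [Fintype S] [DecidableEq S] {Λ : ℝ≥0 → OpMap S}

theorem corr2_probe (hΛ : IsDynamics Λ) {k : Type*} [Fintype k] [DecidableEq k]
    {ρ' ρ'' : Matrix (k × S) (k × S) ℂ} (h' : IsState ρ') (h'' : IsState ρ'') (t : ℝ≥0) :
    corr2 (probe Λ ρ' ρ'' t) = traceNorm (idTensor k (Λ t) ρ' - idTensor k (Λ t) ρ'') / 4 :=
  corr2_cqState (isState_idTensor (hΛ t).1 (hΛ t).2 h') (isState_idTensor (hΛ t).1 (hΛ t).2 h'')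

theorem corr2_probe_le (hΛ : IsDynamics Λ) {k : Type*} [Fintype k] [DecidableEq k]
    {ρ' ρ'' : Matrix (k × S) (k × S) ℂ} (h' : IsState ρ') (h'' : IsState ρ'') {s t : ℝ≥0}
    {V : OpMap S} (hV : IsIntermediateMap Λ s t V) (hcp : IsCP V) :
    corr2 (probe Λ ρ' ρ'' s) ≤ corr2 (probe Λ ρ' ρ'' t) := by
  rw [corr2_probe hΛ h' h'', corr2_probe hΛ h' h'', hV.2, idTensor_comp, idTensor_comp,
    ← idTensor_sub V]
  refine div_le_div_of_nonneg_right (traceNorm_idTensor_le hcp hV.1 ?_ ?_) (by norm_num)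
  · exact (idTensor_posSemidef (hΛ t).1 h'.1).1.sub (idTensor_posSemidef (hΛ t).1 h''.1).1
  · rw [Matrix.trace_sub, trace_idTensor (hΛ t).2, trace_idTensor (hΛ t).2, h'.2, h''.2, sub_self]

variable [Nonempty S]

/-- At a time of bijectivity, the preimage under `id ⊗ Λ τ` of the maximally entangled state
turns into the Choi matrix of the intermediate map, so that one pair of states serves for all
later times. -/
theorem exists_states_detecting (hΛ : IsDynamics Λ) (τ : ℝ≥0) :
    ∃ ρ' ρ'' : Matrix (Option S × S) (Option S × S) ℂ, IsState ρ' ∧ IsState ρ'' ∧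
      (Function.Bijective (Λ τ) → ∀ s, (¬ ∃ V : OpMap S, IsIntermediateMap Λ s τ V ∧ IsCP V) →
        corr2 (probe Λ ρ' ρ'' τ) < corr2 (probe Λ ρ' ρ'' s)) := by
  by_cases hb : Function.Bijective (Λ τ)
  swap
  · obtain ⟨ρ', ρ'', h', h'', -⟩ := exists_states_sub_eq (S := S) isHermitian_zero (by simp)
    exact ⟨ρ', ρ'', h', h'', fun h => absurd h hb⟩
  let e := LinearEquiv.ofBijective (Λ τ) hb
  let I : OpMap S := e.symm.toLinearMap
  have hI : ∀ X, Λ τ (I X) = X := fun X => e.apply_symm_apply X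
  have hI' : ∀ X, I (Λ τ X) = X := fun X => e.symm_apply_apply X
  have hcomp : Λ τ ∘ₗ I = LinearMap.id := LinearMap.ext hI
  have hcomp' : I ∘ₗ Λ τ = LinearMap.id := LinearMap.ext hI'
  set Z := idTensor S I (entangledState S) with hZdef
  have hZ1 : idTensor S (Λ τ) Z = entangledState S := by
    rw [hZdef, ← idTensor_comp, hcomp]; rfl
  have hZ : Z.IsHermitian := by
    have h1 : idTensor S (Λ τ) Zᴴ = idTensor S (Λ τ) Z := by
      rw [idTensor_conjTranspose (hΛ τ).1, hZ1, entangledState_posSemidef.1.eq]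
    have h2 := congrArg (idTensor S I) h1
    rw [← idTensor_comp, ← idTensor_comp, hcomp'] at h2
    exact h2
  have htr : 0 ≤ Z.trace := by
    rw [← trace_idTensor (hΛ τ).2, hZ1]
    exact entangledState_posSemidef.trace_nonneg
  obtain ⟨ρ', ρ'', h', h'', r, hr, hsub⟩ := exists_states_sub_eq hZ htr
  refine ⟨ρ', ρ'', h', h'', fun _ s hs => ?_⟩
  have hV : IsIntermediateMap Λ s τ (Λ s ∘ₗ I) := by
    refine ⟨fun X => ?_, LinearMap.ext fun X => ?_⟩
    · rw [LinearMap.comp_apply, (hΛ s).2, ← (hΛ τ).2, hI]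
    · rw [LinearMap.comp_apply, LinearMap.comp_apply, hI']
  rw [corr2_probe hΛ h' h'', corr2_probe hΛ h' h'']
  refine div_lt_div_of_pos_right (traceNorm_lt_of_not_posSemidef (hΛ τ).1 (hΛ τ).2 (hΛ s).1
    (hΛ s).2 hZ (hZ1 ▸ entangledState_posSemidef) (fun h => hs ⟨_, hV, isCP_of_choi ?_⟩)
    h' h'' hr hsub) (by norm_num)
  rwa [idTensor_comp]

theorem exists_probe_of_no_cp_factor (hΛ : IsDynamics Λ) {s τ : ℝ≥0}
    (h : ¬ ∃ W : OpMap S, IsCP W ∧ Λ s = W ∘ₗ Λ τ) :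
    ∃ ρ' ρ'' : Matrix (Option S × S) (Option S × S) ℂ, IsState ρ' ∧ IsState ρ'' ∧
      corr2 (probe Λ ρ' ρ'' τ) < corr2 (probe Λ ρ' ρ'' s) := by
  obtain ⟨Z, hZ, hpos, hneg⟩ : ∃ Z : Matrix (S × S) (S × S) ℂ, Z.IsHermitian ∧
      (idTensor S (Λ τ) Z).PosSemidef ∧ ¬ (idTensor S (Λ s) Z).PosSemidef := by
    by_contra! hcon
    exact h (exists_cp_factor (hΛ τ).1 hcon)
  have htr : 0 ≤ Z.trace := by
    rw [← trace_idTensor (hΛ τ).2]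
    exact hpos.trace_nonneg
  obtain ⟨ρ', ρ'', h', h'', r, hr, hsub⟩ := exists_states_sub_eq hZ htr
  refine ⟨ρ', ρ'', h', h'', ?_⟩
  rw [corr2_probe hΛ h' h'', corr2_probe hΛ h' h'']
  exact div_lt_div_of_pos_right (traceNorm_lt_of_not_posSemidef (hΛ τ).1 (hΛ τ).2 (hΛ s).1
    (hΛ s).2 hZ hpos hneg h' h'' hr hsub) (by norm_num)

omit [Nonempty S] in
/-- If completely positive intermediate maps to the time `s` exist from bijective times
arbitrarily close to `τ`, then one exists from `τ`. -/
theorem exists_intermediate_of_forall_near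
    (hbij : IsAtMostPointwiseNonBijective Λ) (hcont : ∀ X, Continuous fun t => Λ t X)
    {s τ u : ℝ≥0} (hu : τ < u)
    (h : ∀ t, τ < t → t < u → Function.Bijective (Λ t) →
      ∃ V : OpMap S, IsIntermediateMap Λ s t V ∧ IsCP V) :
    ∃ V : OpMap S, IsIntermediateMap Λ s τ V ∧ IsCP V := by
  have hchoose : ∀ n : ℕ, ∃ t : ℝ≥0, τ < t ∧ t < τ + 1 / (n + 1) ∧
      ∃ V : OpMap S, IsIntermediateMap Λ s t V ∧ IsCP V := fun n => by
    obtain ⟨t, ⟨h1, h2⟩, hb⟩ := hbij τ (min u (τ + 1 / (n + 1)))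
      (lt_min hu (lt_add_of_pos_right _ (by positivity)))
    exact ⟨t, h1, h2.trans_le (min_le_right _ _), h t h1 (h2.trans_le (min_le_left _ _)) hb⟩
  choose t ht1 ht2 V hV hcp using hchoose
  have htlim : Filter.Tendsto t Filter.atTop (nhds τ) := by
    refine tendsto_of_tendsto_of_tendsto_of_le_of_le tendsto_const_nhds ?_
      (fun n => (ht1 n).le) (fun n => (ht2 n).le)
    simpa using (tendsto_const_nhds (x := τ)).add
      (tendsto_one_div_add_atTop_nhds_zero_nat (𝕜 := ℝ≥0))
  obtain ⟨W, h1, h2, h3⟩ := exists_cptp_factor_of_tendsto (Ψ := Λ s) (Φ := Λ τ)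
    (Φs := fun n => Λ (t n)) hcp (fun n => (hV n).1) (fun n => (hV n).2)
    (fun X => ((hcont X).tendsto τ).comp htlim)
  exact ⟨W, ⟨h2, h3⟩, h1⟩

end Probe

end QInfo

theorem mainTheorem1 {S : Type*} [Fintype S] [DecidableEq S] [Nonempty S]
    (Λ : ℝ≥0 → OpMap S) (hΛ : IsDynamics Λ) (hbij : IsAtMostPointwiseNonBijective Λ) :
    -- values of the correlation measures on every probe, at every time
    (∀ (A' : Type*) [Fintype A'] [DecidableEq A'] (ρ' ρ'' : Matrix (A' × S) (A' × S) ℂ),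
      IsState ρ' → IsState ρ'' → ∀ t : ℝ≥0,
        corr (probe Λ ρ' ρ'' t) = corr2 (probe Λ ρ' ρ'' t) ∧
        corr2 (probe Λ ρ' ρ'' t) = corrAn 2 (probe Λ ρ' ρ'' t) ∧
        corrAn 2 (probe Λ ρ' ρ'' t) =
          traceNorm (idTensor A' (Λ t) ρ' - idTensor A' (Λ t) ρ'') / 4 ∧
        corrA (probe Λ ρ' ρ'' t) = corrAn 2 (probe Λ ρ' ρ'' t) ∧
        corrB (probe Λ ρ' ρ'' t) = corrBn 2 (probe Λ ρ' ρ'' t) ∧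
        corrBn 2 (probe Λ ρ' ρ'' t) ≤ corrAn 2 (probe Λ ρ' ρ'' t)) ∧
    -- the probes indexed by `τ`, with an ancilla `A'` of dimension `d + 1`
    (∃ ρ' ρ'' : ℝ≥0 → Matrix (Option S × S) (Option S × S) ℂ,
      (∀ τ, IsState (ρ' τ) ∧ IsState (ρ'' τ)) ∧
      (∀ τ, Function.Bijective (Λ τ) → ∀ Δt : ℝ≥0, 0 < Δt →
        (corr2 (probe Λ (ρ' τ) (ρ'' τ) (τ + Δt)) > corr2 (probe Λ (ρ' τ) (ρ'' τ) τ) ↔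
          ¬ ∃ V : OpMap S, IsIntermediateMap Λ (τ + Δt) τ V ∧ IsCP V)) ∧
      ((∀ X : Matrix S S ℂ, Continuous fun t => Λ t X) →
        ∀ τ Δt : ℝ≥0, 0 < Δt →
          (¬ ∃ V : OpMap S, IsIntermediateMap Λ (τ + Δt) τ V ∧ IsCP V) →
          ∀ ε : ℝ≥0, 0 < ε → ∃ τ' : ℝ≥0, τ < τ' ∧ τ' < τ + ε ∧ τ' < τ + Δt ∧
            Function.Bijective (Λ τ') ∧
            corr2 (probe Λ (ρ' τ') (ρ'' τ') (τ + Δt)) >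
              corr2 (probe Λ (ρ' τ') (ρ'' τ') τ'))) ∧
    -- every time `τ`, including those at which `Λ τ` is not bijective
    (∀ τ Δt : ℝ≥0, 0 < Δt →
      (∀ (A' : Type*) [Fintype A'] [DecidableEq A'] (ρ' ρ'' : Matrix (A' × S) (A' × S) ℂ),
        IsState ρ' → IsState ρ'' →
        corr2 (probe Λ ρ' ρ'' (τ + Δt)) > corr2 (probe Λ ρ' ρ'' τ) →
          ¬ ∃ V : OpMap S, IsIntermediateMap Λ (τ + Δt) τ V ∧ IsCP V) ∧
      ((¬ ∃ W : OpMap S, IsCP W ∧ Λ (τ + Δt) = W ∘ₗ Λ τ) →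
        ∃ ρ' ρ'' : Matrix (Option S × S) (Option S × S) ℂ, IsState ρ' ∧ IsState ρ'' ∧
          corr2 (probe Λ ρ' ρ'' (τ + Δt)) > corr2 (probe Λ ρ' ρ'' τ))) := by
  choose ρ' ρ'' h' h'' hdet using QInfo.exists_states_detecting hΛ
  have hiff : ∀ τ, Function.Bijective (Λ τ) → ∀ s : ℝ≥0,
      (corr2 (probe Λ (ρ' τ) (ρ'' τ) s) > corr2 (probe Λ (ρ' τ) (ρ'' τ) τ) ↔
        ¬ ∃ V : OpMap S, IsIntermediateMap Λ s τ V ∧ IsCP V) := fun τ hb s =>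
    ⟨fun h ⟨V, hV, hcp⟩ => (QInfo.corr2_probe_le hΛ (h' τ) (h'' τ) hV hcp).not_gt h,
      hdet τ hb s⟩
  refine ⟨?_, ⟨ρ', ρ'', fun τ => ⟨h' τ, h'' τ⟩, fun τ hb Δt _ => hiff τ hb _, ?_⟩, ?_⟩
  · intro A' _ _ σ' σ'' hσ' hσ'' t
    have h0 := QInfo.isState_idTensor (hΛ t).1 (hΛ t).2 hσ'
    have h1 := QInfo.isState_idTensor (hΛ t).1 (hΛ t).2 hσ''
    obtain ⟨a1, a2⟩ := QInfo.corrA_cqState h0 h1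
    obtain ⟨b1, b2⟩ := QInfo.corrB_cqState h0 h1
    refine ⟨?_, (QInfo.corr2_cqState h0 h1).trans a2.symm, a2, a1, b1, b2.trans_eq a2.symm⟩
    unfold corr corr2 probe
    rw [a1, b1]
  · intro hcont τ Δt hΔ hno ε hε
    by_contra! hcon
    refine hno (QInfo.exists_intermediate_of_forall_near hbij hcont
      (u := min (τ + ε) (τ + Δt)) (lt_min (lt_add_of_pos_right _ hε) (lt_add_of_pos_right _ hΔ))
      fun t ht1 ht2 hb => ?_)
    by_contra hV
    exact (hcon t ht1 (ht2.trans_le (min_le_left _ _)) (ht2.trans_le (min_le_right _ _)) hb).not_gt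
      ((hiff t hb _).2 hV)
  · intro τ Δt _
    refine ⟨?_, fun hW => QInfo.exists_probe_of_no_cp_factor hΛ hW⟩
    rintro A' _ _ σ' σ'' hσ' hσ'' hgt ⟨V, hV, hcp⟩
    exact (QInfo.corr2_probe_le hΛ hσ' hσ'' hV hcp).not_gt hgt
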